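/- A plain datalog program $\pi$ is a finite set of rules $C(\bar X)\leftarrow R_1(\bar U_1)\wedge\dots\wedge R_s(\bar U_s)$ in which every variable of the head occurs in the body. Relation symbols occurring in rule heads are called intensional (IDB), the other ones extensional (EDB). The program is *monadic* if every head has arity $1$, *linear* if every body contains at most one IDB atom, and *connected* if for every rule the graph on the variables of its body, in which two variables are adjacent when they occur in a common body atom, is connected. A connected linear monadic plain datalog query is a pair $(\pi,G)$ of a connected linear monadic program $\pi$ and a unary IDB symbol $G$ of $\pi$. For a finite database $D$ over the EDB symbols of $\pi$ and an object $d$, we write $D,\pi\models G(d)$ if $G(d)$ belongs to every model of $\pi$ and $D$ (that is, every set of ground atoms that is obtained from $D$ by adding IDB atoms over the objects of $D$ and that satisfies all rules of $\pi$). The query $(\pi,G)$ is *bounded* (predicate boundedness) if there is a number $k$ such that for every such $D$ and $d$, $D,\pi\models G(d)$ if and only if $G(d)$ is obtained from $D$ in at most $k$ rounds of simultaneous application of all rules of $\pi$. **Lemma.** The problem of deciding, given a connected linear monadic plain datalog query $(\pi,G)$, whether $(\pi,G)$ is bounded, is \textsc{PSpace}-hard under polynomial-time many-one reductions. That is, for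 every finite alphabet $A$ and every language $L\subseteq A^*$ that is decided by a deterministic Turing machine $M$ in space $p(|w|)$ on each input $w$, for some polynomial $p$, there is a polynomial-time computable function that maps each word $w\in A^*$ to a connected linear monadic plain datalog query $(\pi_w,G_w)$ such that $(\pi_w,G_w)$ is bounded if and only if $w\in L$, i.e. if and only if $M$ accepts $w$. -/

import Mathlib

/-! ### Plain datalog: syntax -/

/-- An atom `R(x₁, …, xₘ)`: the name of its relation symbol (relation symbols and variables are
named by natural numbers) and the list of its arguments. Arguments are variables in rules and
domain objects in databases. -/
@[ext] structure DatalogAtom where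
  name : ℕ
  args : List ℕ

/-- A relation symbol: a name together with an arity. -/
abbrev RelSym : Type := ℕ × ℕ

/-- The relation symbol of an atom. -/
def DatalogAtom.rel (a : DatalogAtom) : RelSym := (a.name, a.args.length)

/-- Replace every argument of an atom by its value under `ν`. -/
def DatalogAtom.subst (ν : ℕ → ℕ) (a : DatalogAtom) : DatalogAtom :=
  ⟨a.name, a.args.map ν⟩

/-- A plain datalog rule `head ← body₁ ∧ … ∧ bodyₛ`. -/
@[ext] structure DatalogRule where
  head : DatalogAtom
  body : List DatalogAtom

namespace DatalogRule

/-- The variables of the body. -/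
def bodyVars (r : DatalogRule) : Set ℕ := {v | ∃ a ∈ r.body, v ∈ a.args}

/-- All variables of the head occur in the body. -/
def Safe (r : DatalogRule) : Prop := ∀ v ∈ r.head.args, v ∈ r.bodyVars

/-- The Gaifman graph of the body, as a graph on all variable names: two distinct variables are
adjacent if they occur in the same body atom. -/
def gaifman (r : DatalogRule) : SimpleGraph ℕ :=
  SimpleGraph.fromRel fun v w => ∃ a ∈ r.body, v ∈ a.args ∧ w ∈ a.args

/-- The Gaifman graph of the body is connected (on the variables of the body; variables that do
not occur in the body have no edges). -/
def Connected (r : DatalogRule) : Prop :=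
  ∀ v ∈ r.bodyVars, ∀ w ∈ r.bodyVars, r.gaifman.Reachable v w

end DatalogRule

/-- A program: a finite list of rules. -/
abbrev DatalogProgram : Type := List DatalogRule

namespace DatalogProgram

/-- The intensional relation symbols: those of the rule heads. -/
def IDB (π : DatalogProgram) : Set RelSym := {R | ∃ r ∈ π, r.head.rel = R}

/-- The extensional relation symbols: those that occur in the program but in no rule head. -/
def EDB (π : DatalogProgram) : Set RelSym :=
  {R | (∃ r ∈ π, ∃ a ∈ r.body, a.rel = R) ∧ R ∉ π.IDB}

/-- Every rule head has arity 1. -/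
def Monadic (π : DatalogProgram) : Prop := ∀ r ∈ π, r.head.args.length = 1

open Classical in
/-- Every rule body contains at most one occurrence of an intensional atom. -/
def Linear (π : DatalogProgram) : Prop :=
  ∀ r ∈ π, (r.body.filter fun a => decide (a.rel ∈ π.IDB)).length ≤ 1

/-- Every rule is connected. -/
def Connected (π : DatalogProgram) : Prop := ∀ r ∈ π, r.Connected

end DatalogProgram

/-! ### Plain datalog: semantics -/

/-- A (possibly infinite) set of ground atoms; domain objects are natural numbers. -/
abbrev GroundAtoms : Type := Set DatalogAtom

/-- The set of objects that occur in a set of ground atoms. -/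
def GroundAtoms.objects (D : GroundAtoms) : Set ℕ := {o | ∃ a ∈ D, o ∈ a.args}

namespace DatalogProgram

/-- `D` is a (finite) database over the extensional schema of `π`. -/
def IsDatabase (π : DatalogProgram) (D : GroundAtoms) : Prop :=
  D.Finite ∧ ∀ a ∈ D, a.rel ∈ π.EDB

/-- `E` is a model of `π` and `D`: it adds to `D` only intensional atoms, on objects of `D`, and
it satisfies every rule of `π`. -/
structure IsModel (π : DatalogProgram) (D E : GroundAtoms) : Prop where
  schema : ∀ a ∈ E, a.rel ∈ π.EDB ∪ π.IDB
  edb : ∀ a : DatalogAtom, a.rel ∈ π.EDB → (a ∈ E ↔ a ∈ D)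
  objects : E.objects = D.objects
  rules : ∀ r ∈ π, ∀ ν : ℕ → ℕ, (∀ a ∈ r.body, a.subst ν ∈ E) → r.head.subst ν ∈ E

/-- `D, π ⊨ a`: the ground atom `a` belongs to every model of `π` and `D`. -/
def Entails (π : DatalogProgram) (D : GroundAtoms) (a : DatalogAtom) : Prop :=
  ∀ E, π.IsModel D E → a ∈ E

/-- The atoms obtained from `D` in at most `k` rounds, each of which applies all rules of `π` to
all the atoms obtained before. -/
def stage (π : DatalogProgram) (D : GroundAtoms) : ℕ → GroundAtoms
  | 0 => D
  | k + 1 => π.stage D k ∪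
      {b | ∃ r ∈ π, ∃ ν : ℕ → ℕ, (∀ a ∈ r.body, a.subst ν ∈ π.stage D k) ∧ r.head.subst ν = b}

end DatalogProgram

/-- A connected linear monadic plain datalog query `(π, G)`: a connected linear monadic program
together with (the name of) an intensional goal predicate `G` of arity 1. -/
@[ext] structure CLMQuery where
  goal : ℕ
  program : DatalogProgram
  safe : ∀ r ∈ program, r.Safe
  monadic : program.Monadic
  linear : program.Linear
  connected : program.Connected
  goal_mem : (goal, 1) ∈ program.IDB

/-- (Predicate) boundedness: there is a number `k` such that over every database each certain
answer to the query is derived in at most `k` rounds. -/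
def CLMQuery.Bounded (q : CLMQuery) : Prop :=
  ∃ k : ℕ, ∀ D : GroundAtoms, q.program.IsDatabase D →
    ∀ d : ℕ, q.program.Entails D ⟨q.goal, [d]⟩ ↔ ⟨q.goal, [d]⟩ ∈ q.program.stage D k

/-! ### Queries as words -/

/-- The alphabet in which queries are written down. -/
inductive Token
  | tick
  | nameEnd
  | atomEnd
  | ruleEnd

/-- A name is written in unary. (A query in which names are written in binary can be computed from
this one in polynomial time, so hardness in unary implies hardness in binary.) -/
def encodeName (n : ℕ) : List Token := List.replicate n Token.tick ++ [Token.nameEnd]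

def DatalogAtom.encode (a : DatalogAtom) : List Token :=
  encodeName a.name ++ a.args.flatMap encodeName ++ [Token.atomEnd]

def DatalogRule.encode (r : DatalogRule) : List Token :=
  r.head.encode ++ r.body.flatMap DatalogAtom.encode ++ [Token.ruleEnd]

def CLMQuery.encode (q : CLMQuery) : List Token :=
  encodeName q.goal ++ q.program.flatMap DatalogRule.encode

theorem encodeName_cancel {m n : ℕ} {s t : List Token}
    (h : encodeName m ++ s = encodeName n ++ t) : m = n ∧ s = t := by
  induction m generalizing n with
  | zero => cases n <;> simp_all [encodeName, List.replicate_succ]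
  | succ m ih =>
    cases n with
    | zero => simp [encodeName, List.replicate_succ] at h
    | succ n =>
      have := @ih n (by simpa [encodeName, List.replicate_succ] using h)
      exact ⟨by omega, this.2⟩

theorem flatMap_cancel {X : Type} {f : X → List Token} {e : Token}
    (hf : ∀ (x y : X) (s t : List Token), f x ++ s = f y ++ t → x = y ∧ s = t)
    (he : ∀ (x : X) (s t : List Token), f x ++ s ≠ e :: t) :
    ∀ {l l' : List X} {s t : List Token},
      l.flatMap f ++ e :: s = l'.flatMap f ++ e :: t → l = l' ∧ s = t
  | [], [], s, t, h => by simpa using h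
  | [], y :: l', s, t, h => by
    simp only [List.flatMap_nil, List.nil_append, List.flatMap_cons, List.append_assoc] at h
    exact absurd h.symm (he _ _ _)
  | x :: l, [], s, t, h => by
    simp only [List.flatMap_nil, List.nil_append, List.flatMap_cons, List.append_assoc] at h
    exact absurd h (he _ _ _)
  | x :: l, y :: l', s, t, h => by
    simp only [List.flatMap_cons, List.append_assoc] at h
    obtain ⟨rfl, h1⟩ := hf _ _ _ _ h
    obtain ⟨rfl, h2⟩ := flatMap_cancel hf he h1
    exact ⟨rfl, h2⟩

theorem encodeName_ne {n : ℕ} {e : Token} (h1 : e ≠ Token.tick) (h2 : e ≠ Token.nameEnd)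
    (s t : List Token) : encodeName n ++ s ≠ e :: t := by
  cases n <;> simp [encodeName, List.replicate_succ, h1.symm, h2.symm]

theorem DatalogAtom.encode_cancel (a b : DatalogAtom) (s t : List Token)
    (h : a.encode ++ s = b.encode ++ t) : a = b ∧ s = t := by
  simp only [DatalogAtom.encode, List.append_assoc, List.singleton_append] at h
  obtain ⟨h1, h⟩ := encodeName_cancel h
  obtain ⟨h2, h⟩ := flatMap_cancel (fun _ _ _ _ => encodeName_cancel)
    (fun _ => encodeName_ne (by simp) (by simp)) h
  exact ⟨DatalogAtom.ext h1 h2, h⟩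

theorem DatalogAtom.encode_ne {a : DatalogAtom} (s t : List Token) :
    a.encode ++ s ≠ Token.ruleEnd :: t := by
  simp only [DatalogAtom.encode, List.append_assoc]
  exact encodeName_ne (by simp) (by simp) _ _

theorem DatalogRule.encode_cancel (a b : DatalogRule) (s t : List Token)
    (h : a.encode ++ s = b.encode ++ t) : a = b ∧ s = t := by
  simp only [DatalogRule.encode, List.append_assoc, List.singleton_append] at h
  obtain ⟨h1, h⟩ := DatalogAtom.encode_cancel _ _ _ _ h
  obtain ⟨h2, h⟩ := flatMap_cancel DatalogAtom.encode_cancel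
    (fun _ => DatalogAtom.encode_ne) h
  exact ⟨DatalogRule.ext h1 h2, h⟩

/-- Different queries are written as different words. -/
theorem CLMQuery.encode_injective : Function.Injective CLMQuery.encode := by
  intro p q h
  simp only [CLMQuery.encode] at h
  obtain ⟨h1, h⟩ := encodeName_cancel h
  have h' := congrArg (· ++ [Token.ruleEnd]) h
  obtain ⟨h2, -⟩ := flatMap_cancel DatalogRule.encode_cancel
    (fun r s t => by
      simp only [DatalogRule.encode, List.append_assoc]
      exact DatalogAtom.encode_ne _ _) h'
  exact CLMQuery.ext h1 h2

/-! ### Polynomial space -/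

/-- A deterministic Turing machine over the input alphabet `α`, with one tape that is infinite to
the right. -/
structure TapeMachine (α : Type) where
  /-- the states -/
  Q : Type
  /-- the tape symbols -/
  S : Type
  [finQ : Fintype Q]
  [finS : Fintype S]
  blank : S
  /-- the input symbols among the tape symbols -/
  input : α → S
  input_injective : Function.Injective input
  input_ne_blank : ∀ a, input a ≠ blank
  start : Q
  accept : Q
  reject : Q
  accept_ne_reject : accept ≠ reject
  δ : Q → S → Q × S × Turing.Dir

namespace TapeMachine

variable {α : Type}

/-- A configuration: the state, the position of the head, the content of the tape. -/
structure Config (M : TapeMachine α) where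
  state : M.Q
  head : ℕ
  tape : ℕ → M.S

/-- The machine has stopped. -/
def Config.Halted {M : TapeMachine α} (c : M.Config) : Prop :=
  c.state = M.accept ∨ c.state = M.reject

/-- The initial configuration on input `w`: the head is on the leftmost cell, and the tape holds
`w` followed by blanks. -/
def init (M : TapeMachine α) (w : List α) : M.Config where
  state := M.start
  head := 0
  tape i := match w[i]? with
    | some a => M.input a
    | none => M.blank

open Classical in
/-- One step of the machine. A halted machine does not change any more; a head that is told to move
to the left from the leftmost cell stays there. -/
noncomputable def step (M : TapeMachine α) (c : M.Config) : M.Config :=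
  if c.Halted then c
  else
    match M.δ c.state (c.tape c.head) with
    | (q, b, d) =>
      { state := q
        head := match d with
          | Turing.Dir.left => c.head - 1
          | Turing.Dir.right => c.head + 1
        tape := Function.update c.tape c.head b }

/-- The configuration after `t` steps on input `w`. -/
noncomputable def run (M : TapeMachine α) (w : List α) (t : ℕ) : M.Config :=
  M.step^[t] (M.init w)

/-- `M` halts on every input and accepts exactly the words of `L`. -/
def Decides (M : TapeMachine α) (L : Language α) : Prop :=
  ∀ w, (∃ t, (M.run w t).Halted) ∧ (w ∈ L ↔ ∃ t, (M.run w t).state = M.accept)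

/-- On input `w` the head of `M` only ever visits the first `s` cells. -/
def RunsInSpace (M : TapeMachine α) (w : List α) (s : ℕ) : Prop :=
  ∀ t, (M.run w t).head < s

end TapeMachine

/-- The class PSpace. -/
def InPSpace {α : Type} (L : Language α) : Prop :=
  ∃ (M : TapeMachine α) (p : Polynomial ℕ),
    M.Decides L ∧ ∀ w : List α, M.RunsInSpace w (p.eval w.length)

/-- The decision problem "given `x : I`, does `P x` hold?", where instances are written as words by
means of `enc`, is PSpace-hard: every language in PSpace over a finite alphabet is reducible to it
by a many-one reduction that is computable in polynomial time on a Turing machine. -/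
def PSpaceHard {I Γ : Type} (enc : I → List Γ) (P : I → Prop) : Prop :=
  ∀ (α : Type) [Fintype α] (L : Language α), InPSpace L →
    ∃ f : List α → I,
      Nonempty (Turing.TM2ComputableInPolyTime (Computability.encodingList α).encode enc f) ∧
      ∀ w : List α, w ∈ L ↔ P (f w)

/-!
Deciding boundedness of connected linear monadic queries is hard for polynomial space, because such
queries can look for errors in computations.

A rule of the form `p(x) ← a(x, y) ∧ q(y)` or `p(x) ← a(x, y)` is a transition of a nondeterministic
automaton that reads the letter `a` in the state `p` and then passes on to `q`, or accepts. If all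
rules have this form, then `p(d)` is derived in `k` rounds iff some word of length at most `k` that is
accepted from `p` labels a path that starts in `d` (`automatonProgram.mem_stage_iff`). Path-shaped
databases show that the query is bounded iff there is a `k` such that every accepted word has an
accepted prefix of length at most `k` (`automatonQuery_bounded_iff`).

Let `M` be a machine that decides `L` and whose head stays among the cells `0, …, s` on the input `w`.
A word over the letters "state, symbol read, is the head on the leftmost cell?" describes a purported
computation of `M`. The automaton `TapeMachine.ErrorRule` reads a letter `begin` and then guesses what
to keep track of: the state of `M`, or the content of one cell `i ≤ s`. In the second case it
remembers the symbol on the cell and the distance of the head from it, with the side. Both are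
updated from the letters, so `O(s)` states suffice. The automaton accepts as soon as the letter read
differs from what it has kept track of, or shows the accepting state. A third guess is to wait for
a letter `finish`, or for another `begin`, which is out of place. If `M` accepts `w` after `t` steps,
then among the first `t + 1` letters after `begin` of any longer word there is an error or the
accepting state, and some guess notices it (`TapeMachine.exists_tracked_of_accept`). If `M` does not
accept, then the true computation followed by `finish` is accepted by waiting, at any length, but none
of its shorter prefixes is (`TapeMachine.Tracks.not_accepts_of_prefix_trace`). So the automaton is
prefix bounded iff `M` accepts (`TapeMachine.prefixBounded_errorRule_iff`).

The transitions depend on the level, that is, the distance of the head from the observed cell, in a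
uniform way: those on level `e + 1` are the instances of a fixed finite list of templates, the list
being determined by letter `e + 1` of the input. A stack machine therefore computes a power
`s = (n + c) ^ k` above the space bound in unary and writes the instances level by level. The machine
is given as a structured program (`StackProgram`) with a time-bounded semantics
(`StackProgram.Exec`), which is compiled to the multi-stack machines of Mathlib
(`StackProgram.Exec.stepsWithin`, `StackProgram.nonempty_computable`).
-/

/-! ### Automata as datalog queries -/

/-- The words accepted from a state by the automaton with the transitions `R`. A transition
`R p a o` reads the letter `a` in the state `p`; it accepts if `o = none` and passes on to the
state `q` if `o = some q`. -/
inductive Accepts {σ Λ : Type} (R : σ → Λ → Option σ → Prop) : σ → List Λ → Prop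
  | last {p a} : R p a none → Accepts R p [a]
  | cons {p a q u} : R p a (some q) → Accepts R q u → Accepts R p (a :: u)

/-- The lengths of the prefix-minimal words accepted from `p` are bounded. -/
def PrefixBounded {σ Λ : Type} (R : σ → Λ → Option σ → Prop) (p : σ) : Prop :=
  ∃ k, ∀ u, Accepts R p u → ∃ v, v <+: u ∧ v.length ≤ k ∧ Accepts R p v

/-- A transition of an automaton whose states and letters are natural numbers. -/
abbrev NatTransition : Type := ℕ × ℕ × Option ℕ

namespace NatTransition

/-- The rule of a transition: `p(x) ← a(x, y)` or `p(x) ← a(x, y) ∧ q(y)`. -/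
def rule (t : NatTransition) : DatalogRule where
  head := ⟨t.1, [0]⟩
  body := ⟨t.2.1, [0, 1]⟩ :: (t.2.2.map fun q => (⟨q, [1]⟩ : DatalogAtom)).toList

theorem rule_safe (t : NatTransition) : t.rule.Safe := by
  intro v hv
  exact ⟨⟨t.2.1, [0, 1]⟩, by simp [rule], by simp_all [rule]⟩

theorem bodyVars_rule (t : NatTransition) {v : ℕ} (h : v ∈ t.rule.bodyVars) : v = 0 ∨ v = 1 := by
  obtain ⟨p, a, o⟩ := t
  obtain ⟨b, hb, hv⟩ := h
  cases o <;> simp [rule] at hb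
  · subst hb; simpa using hv
  · rcases hb with rfl | rfl <;> simp at hv <;> omega

theorem rule_connected (t : NatTransition) : t.rule.Connected := by
  have key : t.rule.gaifman.Reachable 0 1 := by
    refine SimpleGraph.Adj.reachable ?_
    rw [DatalogRule.gaifman, SimpleGraph.fromRel_adj]
    exact ⟨by simp, .inl ⟨⟨t.2.1, [0, 1]⟩, by simp [rule], by simp⟩⟩
  intro v hv w hw
  rcases bodyVars_rule t hv with rfl | rfl <;> rcases bodyVars_rule t hw with rfl | rfl
  exacts [.refl _, key, key.symm, .refl _]

end NatTransition

/-- The program of an automaton. -/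
def automatonProgram (Δ : List NatTransition) : DatalogProgram := Δ.map NatTransition.rule

namespace automatonProgram

variable {Δ : List NatTransition}

theorem mem_IDB {n m : ℕ} :
    (n, m) ∈ (automatonProgram Δ).IDB ↔ m = 1 ∧ ∃ t ∈ Δ, t.1 = n := by
  simp only [DatalogProgram.IDB, automatonProgram, List.mem_map, Set.mem_ofPred_eq,
    exists_exists_and_eq_and, NatTransition.rule, DatalogAtom.rel, Prod.mk.injEq,
    List.length_singleton]
  constructor
  · rintro ⟨t, h, h1, h2⟩; exact ⟨h2.symm, t, h, h1⟩
  · rintro ⟨rfl, t, h, h1⟩; exact ⟨t, h, h1, rfl⟩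

theorem monadic : (automatonProgram Δ).Monadic := by
  intro r hr
  obtain ⟨t, -, rfl⟩ := List.mem_map.1 hr
  rfl

theorem linear : (automatonProgram Δ).Linear := by
  intro r hr
  obtain ⟨⟨p, a, o⟩, -, rfl⟩ := List.mem_map.1 hr
  have h : ¬ (a, 2) ∈ (automatonProgram Δ).IDB := by simp [mem_IDB]
  cases o with
  | none => simp [NatTransition.rule, DatalogAtom.rel, h]
  | some q =>
    simp only [NatTransition.rule, DatalogAtom.rel, Option.map_some, Option.toList_some]
    rw [List.filter_cons_of_neg (by simp [h])]
    exact (List.length_filter_le _ _)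

/-- Every state that a transition leads to has a transition of its own, so that the states are
exactly the intensional symbols. -/
def Closed (Δ : List NatTransition) : Prop :=
  ∀ p a q, (p, a, some q) ∈ Δ → ∃ t ∈ Δ, t.1 = q

theorem mem_EDB (hΔ : Closed Δ) {n m : ℕ} :
    (n, m) ∈ (automatonProgram Δ).EDB ↔ m = 2 ∧ ∃ t ∈ Δ, t.2.1 = n := by
  constructor
  · rintro ⟨⟨r, hr, b, hb, hbn⟩, hI⟩
    obtain ⟨⟨p, a, o⟩, ht, rfl⟩ := List.mem_map.1 hr
    rw [mem_IDB] at hI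
    cases o with
    | none =>
      simp [NatTransition.rule] at hb
      subst hb
      simp only [DatalogAtom.rel, Prod.mk.injEq] at hbn
      exact ⟨hbn.2.symm, _, ht, hbn.1⟩
    | some q =>
      simp [NatTransition.rule] at hb
      rcases hb with rfl | rfl <;> simp only [DatalogAtom.rel, Prod.mk.injEq] at hbn
      · exact ⟨hbn.2.symm, _, ht, hbn.1⟩
      · obtain ⟨t, h1, h2⟩ := hΔ _ _ _ ht
        exact absurd ⟨hbn.2.symm, t, h1, h2.trans hbn.1⟩ hI
  · rintro ⟨rfl, t, ht, rfl⟩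
    refine ⟨⟨_, List.mem_map_of_mem ht, ⟨t.2.1, [0, 1]⟩, by simp [NatTransition.rule], rfl⟩, ?_⟩
    simp [mem_IDB]

/-- `u` labels a path of `D` that starts in `d`. -/
def Path (D : GroundAtoms) : ℕ → List ℕ → Prop
  | _, [] => True
  | d, a :: u => ∃ d', ⟨a, [d, d']⟩ ∈ D ∧ Path D d' u

theorem Path.of_prefix {D : GroundAtoms} {u v : List ℕ} (h : v <+: u) :
    ∀ {d : ℕ}, Path D d u → Path D d v := by
  induction v generalizing u with
  | nil => intro d _; trivial
  | cons a v ih =>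
    obtain ⟨w, rfl⟩ := h
    rintro d ⟨d', h1, h2⟩
    exact ⟨d', h1, ih (List.prefix_append _ _) h2⟩

/-- The transitions of a list, as a relation. -/
def Trans (Δ : List NatTransition) (p a : ℕ) (o : Option ℕ) : Prop := (p, a, o) ∈ Δ

variable {D : GroundAtoms}

/-- Derivations add no binary atoms. -/
theorem edge_of_mem_stage {k a d d' : ℕ}
    (h : ⟨a, [d, d']⟩ ∈ (automatonProgram Δ).stage D k) : ⟨a, [d, d']⟩ ∈ D := by
  induction k with
  | zero => exact h
  | succ k ih =>
    rcases h with h | ⟨r, hr, ν, -, h2⟩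
    · exact ih h
    · obtain ⟨t, -, rfl⟩ := List.mem_map.1 hr
      simp [NatTransition.rule, DatalogAtom.subst] at h2

theorem stage_mono {π : DatalogProgram} {k l : ℕ} (h : k ≤ l) : π.stage D k ⊆ π.stage D l := by
  induction h with
  | refl => exact subset_rfl
  | step _ ih => exact ih.trans Set.subset_union_left

/-- The atoms derived in `k` rounds: the paths that are labelled by an accepted word of length at
most `k`. -/
theorem mem_stage_iff (hΔ : Closed Δ) (hD : (automatonProgram Δ).IsDatabase D) {k p d : ℕ} :
    ⟨p, [d]⟩ ∈ (automatonProgram Δ).stage D k ↔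
      ∃ u, u.length ≤ k ∧ Accepts (Trans Δ) p u ∧ Path D d u := by
  induction k generalizing p d with
  | zero =>
    constructor
    · intro h
      have := hD.2 _ h
      rw [DatalogAtom.rel, mem_EDB hΔ] at this
      simp at this
    · rintro ⟨u, hu, h, -⟩
      cases h <;> simp at hu
  | succ k ih =>
    constructor
    · rintro (h | ⟨r, hr, ν, h1, h2⟩)
      · obtain ⟨u, hu, h⟩ := ih.1 h
        exact ⟨u, by omega, h⟩
      · obtain ⟨⟨q, a, o⟩, ht, rfl⟩ := List.mem_map.1 hr
        simp only [NatTransition.rule, DatalogAtom.subst, List.map_cons, List.map_nil,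
          DatalogAtom.mk.injEq, List.cons.injEq, and_true] at h2
        obtain ⟨rfl, rfl⟩ := h2
        have he : ⟨a, [ν 0, ν 1]⟩ ∈ D :=
          edge_of_mem_stage (h1 ⟨a, [0, 1]⟩ (by simp [NatTransition.rule]))
        cases o with
        | none => exact ⟨[a], by simp, .last ht, ν 1, he, trivial⟩
        | some q' =>
          obtain ⟨u, hu, h3, h4⟩ := ih.1 (h1 ⟨q', [1]⟩ (by simp [NatTransition.rule]))
          exact ⟨a :: u, by simpa using hu, .cons ht h3, ν 1, he, h4⟩
    · rintro ⟨u, hu, h, hp⟩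
      have hsub : D ⊆ (automatonProgram Δ).stage D k := stage_mono (Nat.zero_le k)
      cases h with
      | @last _ a h =>
        obtain ⟨d', he, -⟩ := hp
        refine .inr ⟨_, List.mem_map_of_mem h, fun i => if i = 0 then d else d', ?_, ?_⟩
        · simpa [NatTransition.rule, DatalogAtom.subst] using hsub he
        · simp [NatTransition.rule, DatalogAtom.subst]
      | @cons _ a q u h h3 =>
        obtain ⟨d', he, hp⟩ := hp
        refine .inr ⟨_, List.mem_map_of_mem h, fun i => if i = 0 then d else d', ?_, ?_⟩
        · have := ih.2 ⟨u, by simpa using hu, h3, hp⟩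
          simpa [NatTransition.rule, DatalogAtom.subst] using ⟨hsub he, this⟩
        · simp [NatTransition.rule, DatalogAtom.subst]

/-- All atoms that are derived in some round form a model. -/
theorem isModel_iUnion_stage (hD : (automatonProgram Δ).IsDatabase D) :
    (automatonProgram Δ).IsModel D (⋃ k, (automatonProgram Δ).stage D k) := by
  have key : ∀ k, ∀ b ∈ (automatonProgram Δ).stage D k,
      b ∈ D ∨ b.rel ∈ (automatonProgram Δ).IDB ∧ ∀ o ∈ b.args, o ∈ D.objects := by
    intro k
    induction k with
    | zero => exact fun b hb => .inl hb
    | succ k ih =>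
      rintro b (hb | ⟨r, hr, ν, h1, rfl⟩)
      · exact ih b hb
      · refine .inr ⟨⟨r, hr, by simp [DatalogAtom.rel, DatalogAtom.subst]⟩, ?_⟩
        obtain ⟨⟨p, a, o⟩, ht, rfl⟩ := List.mem_map.1 hr
        have he : ⟨a, [ν 0, ν 1]⟩ ∈ D :=
          edge_of_mem_stage (h1 ⟨a, [0, 1]⟩ (by simp [NatTransition.rule]))
        intro o ho
        simp only [NatTransition.rule, DatalogAtom.subst, List.map_cons, List.map_nil,
          List.mem_singleton] at ho
        exact ⟨_, he, by simp [ho]⟩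
  refine ⟨?_, ?_, ?_, ?_⟩
  · intro b hb
    obtain ⟨k, hb⟩ := Set.mem_iUnion.1 hb
    exact (key k b hb).imp (hD.2 b) And.left
  · intro b hb
    refine ⟨fun h => ?_, fun h => Set.mem_iUnion.2 ⟨0, h⟩⟩
    obtain ⟨k, h⟩ := Set.mem_iUnion.1 h
    exact (key k b h).resolve_right fun h => hb.2 h.1
  · ext o
    constructor
    · rintro ⟨b, hb, ho⟩
      obtain ⟨k, hb⟩ := Set.mem_iUnion.1 hb
      exact (key k b hb).elim (fun h => ⟨b, h, ho⟩) fun h => h.2 o ho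
    · rintro ⟨b, hb, ho⟩
      exact ⟨b, Set.mem_iUnion.2 ⟨0, hb⟩, ho⟩
  · intro r hr ν h
    -- The body is finite, so all its atoms are derived in a common round.
    have hex : ∃ k, ∀ b ∈ r.body, b.subst ν ∈ (automatonProgram Δ).stage D k := by
      generalize r.body = l at h
      induction l with
      | nil => exact ⟨0, by simp⟩
      | cons b l ih =>
        obtain ⟨k, hk⟩ := ih fun b hb => h b (List.mem_cons_of_mem _ hb)
        obtain ⟨m, hm⟩ := Set.mem_iUnion.1 (h b List.mem_cons_self)
        refine ⟨max k m, fun c hc => ?_⟩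
        rcases List.mem_cons.1 hc with rfl | hc
        · exact stage_mono (le_max_right _ _) hm
        · exact stage_mono (le_max_left _ _) (hk c hc)
    obtain ⟨k, hk⟩ := hex
    exact Set.mem_iUnion.2 ⟨k + 1, .inr ⟨r, hr, ν, hk, rfl⟩⟩

theorem stage_subset_of_isModel {π : DatalogProgram} {E : GroundAtoms}
    (hD : π.IsDatabase D) (hE : π.IsModel D E) (k : ℕ) : π.stage D k ⊆ E := by
  induction k with
  | zero => exact fun b hb => (hE.edb b (hD.2 b hb)).2 hb
  | succ k ih =>
    rintro b (hb | ⟨r, hr, ν, h1, rfl⟩)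
    · exact ih hb
    · exact hE.rules r hr ν fun a ha => ih (h1 a ha)

theorem entails_iff (hΔ : Closed Δ) (hD : (automatonProgram Δ).IsDatabase D) {p d : ℕ} :
    (automatonProgram Δ).Entails D ⟨p, [d]⟩ ↔ ∃ u, Accepts (Trans Δ) p u ∧ Path D d u := by
  constructor
  · intro h
    obtain ⟨k, h⟩ := Set.mem_iUnion.1 (h _ (isModel_iUnion_stage hD))
    obtain ⟨u, -, h⟩ := (mem_stage_iff hΔ hD).1 h
    exact ⟨u, h⟩
  · rintro ⟨u, h⟩ E hE
    exact stage_subset_of_isModel hD hE u.length ((mem_stage_iff hΔ hD).2 ⟨u, le_rfl, h⟩)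

/-- The database that consists of a single path labelled by `u`. -/
def pathDatabase (u : List ℕ) : GroundAtoms :=
  {b | ∃ i a, u[i]? = some a ∧ b = ⟨a, [i, i + 1]⟩}

theorem path_pathDatabase_iff {u v : List ℕ} {i : ℕ} :
    Path (pathDatabase u) i v ↔ v <+: u.drop i := by
  induction v generalizing i with
  | nil => simp [Path]
  | cons a v ih =>
    simp only [Path, pathDatabase, Set.mem_ofPred_eq, DatalogAtom.mk.injEq, List.cons.injEq,
      and_true]
    constructor
    · rintro ⟨d', ⟨j, b, h1, rfl, rfl, rfl⟩, h2⟩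
      obtain ⟨hi, rfl⟩ := List.getElem?_eq_some_iff.1 h1
      rw [List.drop_eq_getElem_cons hi, List.cons_prefix_cons]
      exact ⟨rfl, ih.1 h2⟩
    · intro h
      have hi : i < u.length := by
        by_contra hi
        rw [List.drop_eq_nil_of_le (by omega)] at h
        simp at h
      rw [List.drop_eq_getElem_cons hi, List.cons_prefix_cons] at h
      exact ⟨i + 1, ⟨i, a, by rw [h.1]; exact List.getElem?_eq_getElem hi, rfl, rfl, rfl⟩,
        ih.2 h.2⟩

theorem exists_transition_of_accepts {p : ℕ} {u : List ℕ} (h : Accepts (Trans Δ) p u) :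
    ∀ a ∈ u, ∃ t ∈ Δ, t.2.1 = a := by
  induction h with
  | last h => exact fun b hb => ⟨_, h, (List.mem_singleton.1 hb).symm⟩
  | cons h _ ih =>
    intro b hb
    rcases List.mem_cons.1 hb with rfl | hb
    exacts [⟨_, h, rfl⟩, ih b hb]

theorem isDatabase_pathDatabase (hΔ : Closed Δ) {p : ℕ} {u : List ℕ}
    (h : Accepts (Trans Δ) p u) : (automatonProgram Δ).IsDatabase (pathDatabase u) := by
  constructor
  · refine (Set.finite_range fun i : Fin u.length =>
      (⟨u[i], [(i : ℕ), i + 1]⟩ : DatalogAtom)).subset ?_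
    rintro b ⟨i, a, h1, rfl⟩
    obtain ⟨hi, rfl⟩ := List.getElem?_eq_some_iff.1 h1
    exact ⟨⟨i, hi⟩, rfl⟩
  · rintro b ⟨i, a, h1, rfl⟩
    rw [DatalogAtom.rel, mem_EDB hΔ]
    exact ⟨rfl, exists_transition_of_accepts h a (List.mem_of_getElem? h1)⟩

end automatonProgram

open automatonProgram in
/-- The query of an automaton and its initial state. -/
def automatonQuery (Δ : List NatTransition) (g : ℕ) (hg : ∃ t ∈ Δ, t.1 = g) : CLMQuery where
  goal := g
  program := automatonProgram Δ
  safe r hr := by obtain ⟨t, -, rfl⟩ := List.mem_map.1 hr; exact t.rule_safe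
  monadic := monadic
  linear := linear
  connected r hr := by obtain ⟨t, -, rfl⟩ := List.mem_map.1 hr; exact t.rule_connected
  goal_mem := mem_IDB.2 ⟨rfl, hg⟩

open automatonProgram in
theorem automatonQuery_bounded_iff {Δ : List NatTransition} (hΔ : Closed Δ) {g : ℕ}
    (hg : ∃ t ∈ Δ, t.1 = g) :
    (automatonQuery Δ g hg).Bounded ↔ PrefixBounded (Trans Δ) g := by
  constructor
  · rintro ⟨k, hk⟩
    refine ⟨k, fun u hu => ?_⟩
    have hD := isDatabase_pathDatabase hΔ hu
    have h1 := (entails_iff hΔ hD).2 ⟨u, hu, (path_pathDatabase_iff (i := 0)).2 (by simp)⟩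
    obtain ⟨v, hv, hv', hp⟩ := (mem_stage_iff hΔ hD).1 ((hk _ hD 0).1 h1)
    exact ⟨v, path_pathDatabase_iff.1 hp, hv, hv'⟩
  · rintro ⟨k, hk⟩
    refine ⟨k, fun D hD d => ?_⟩
    change (automatonProgram Δ).Entails D ⟨g, [d]⟩ ↔
      ⟨g, [d]⟩ ∈ (automatonProgram Δ).stage D k
    rw [entails_iff hΔ hD, mem_stage_iff hΔ hD]
    constructor
    · rintro ⟨u, hu, hp⟩
      obtain ⟨v, hv, hl, hv'⟩ := hk u hu
      exact ⟨v, hl, hv', hp.of_prefix hv⟩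
    · rintro ⟨u, -, h⟩
      exact ⟨u, h⟩

/-- Accepted words of a renamed automaton come from accepted words of the original one. -/
theorem Accepts.of_injective {σ Λ σ' Λ' : Type} {R : σ → Λ → Option σ → Prop}
    {R' : σ' → Λ' → Option σ' → Prop} {f : σ → σ'} {g : Λ → Λ'} (hf : Function.Injective f)
    (h : ∀ p a o, R' p a o → ∃ p' a' o', R p' a' o' ∧ f p' = p ∧ g a' = a ∧ Option.map f o' = o)
    {p : σ} {p' : σ'} (hp : f p = p') {u : List Λ'} (hu : Accepts R' p' u) :
    ∃ v, u = v.map g ∧ Accepts R p v := by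
  induction hu generalizing p with
  | last h1 =>
    obtain ⟨q, b, o, hR, h2, rfl, h3⟩ := h _ _ _ h1
    obtain rfl := hf (h2.trans hp.symm)
    obtain rfl : o = none := by simpa using h3
    exact ⟨[b], rfl, .last hR⟩
  | cons h1 _ ih =>
    obtain ⟨q, b, o, hR, h2, rfl, h3⟩ := h _ _ _ h1
    obtain rfl := hf (h2.trans hp.symm)
    obtain ⟨q', rfl, h4⟩ := Option.map_eq_some_iff.1 h3
    obtain ⟨v, rfl, hv⟩ := ih h4
    exact ⟨b :: v, rfl, .cons hR hv⟩

theorem Accepts.map {σ Λ σ' Λ' : Type} {R : σ → Λ → Option σ → Prop}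
    {R' : σ' → Λ' → Option σ' → Prop} {f : σ → σ'} {g : Λ → Λ'}
    (h : ∀ p a o, R p a o → R' (f p) (g a) (o.map f)) {p : σ} {u : List Λ}
    (hu : Accepts R p u) : Accepts R' (f p) (u.map g) := by
  induction hu with
  | last h1 => exact .last (h _ _ _ h1)
  | cons h1 _ ih => exact .cons (h _ _ _ h1) ih

/-- Renaming states and letters injectively does not change prefix boundedness. -/
theorem prefixBounded_iff_of_injective {σ Λ σ' Λ' : Type} {R : σ → Λ → Option σ → Prop}
    {R' : σ' → Λ' → Option σ' → Prop} {f : σ → σ'} {g : Λ → Λ'} (hf : Function.Injective f)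
    (hg : Function.Injective g)
    (h : ∀ p a o, R' p a o ↔
      ∃ p' a' o', R p' a' o' ∧ f p' = p ∧ g a' = a ∧ Option.map f o' = o) (p : σ) :
    PrefixBounded R' (f p) ↔ PrefixBounded R p := by
  have hmap : ∀ p a o, R p a o → R' (f p) (g a) (o.map f) := fun p a o hR =>
    (h _ _ _).2 ⟨p, a, o, hR, rfl, rfl, rfl⟩
  constructor <;> rintro ⟨k, hk⟩ <;> refine ⟨k, fun u hu => ?_⟩
  · obtain ⟨v, hv, hl, hv'⟩ := hk _ (hu.map hmap)
    obtain ⟨v, rfl, hv''⟩ := Accepts.of_injective hf (fun p a o => (h p a o).1) rfl hv'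
    exact ⟨v, (List.prefix_map_iff_of_injective hg).1 hv, by simpa using hl, hv''⟩
  · obtain ⟨u, rfl, hu'⟩ := Accepts.of_injective hf (fun p a o => (h p a o).1) rfl hu
    obtain ⟨v, hv, hl, hv'⟩ := hk _ hu'
    exact ⟨v.map g, hv.map g, by simpa using hl, hv'.map hmap⟩

/-! ### An automaton that finds the errors in a computation -/

/-- The letters of the words that describe computations: `step q b z` says that the machine is in
the state `q` and reads the symbol `b`, and `z` says whether the head is on the leftmost cell. -/
inductive TraceLetter (Q S : Type)
  | begin
  | finish
  | step (q : Q) (b : S) (z : Bool)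

/-- The states of the error-finding automaton, up to the distance between the head and the
observed cell. -/
inductive Walker (Q S : Type)
  /-- the initial state -/
  | goal
  /-- waits for the end of the word -/
  | main
  /-- expects the machine to be in state `q` -/
  | state (q : Q)
  /-- observes a cell that contains `a` and is the leftmost cell iff `z`; away from the cell, the
  head is on side `d` of it -/
  | cell (d : Turing.Dir) (a : S) (z : Bool)

namespace TapeMachine

variable {α : Type} (M : TapeMachine α)

open Classical in
/-- What the machine does in the state `q` when it reads `b`: the new state, the symbol written and
the move of the head; a halted machine does not move. -/
noncomputable def act (q : M.Q) (b : M.S) : M.Q × M.S × Option Turing.Dir :=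
  if q = M.accept ∨ q = M.reject then (q, b, none)
  else ((M.δ q b).1, (M.δ q b).2.1, some (M.δ q b).2.2)

/-- The move of the head as it is really made: on the leftmost cell there is no move to the left. -/
noncomputable def move (q : M.Q) (b : M.S) (z : Bool) : Option Turing.Dir :=
  if z = true ∧ (M.act q b).2.2 = some .left then none else (M.act q b).2.2

/-- The symbol on cell `i` of the initial tape, which is given by the `i`-th letter of the input,
if there is one. -/
def symbolOf : Option α → M.S
  | some a => M.input a
  | none => M.blank

/-- The letter that describes a configuration. -/
def Config.letter {M : TapeMachine α} (c : M.Config) : TraceLetter M.Q M.S :=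
  .step c.state (c.tape c.head) (decide (c.head = 0))

variable {M}

theorem step_state (c : M.Config) : (M.step c).state = (M.act c.state (c.tape c.head)).1 := by
  unfold step act Config.Halted
  split_ifs <;> rfl

theorem step_tape (c : M.Config) :
    (M.step c).tape = Function.update c.tape c.head (M.act c.state (c.tape c.head)).2.1 := by
  unfold step act Config.Halted
  split_ifs <;> simp

theorem step_head (c : M.Config) :
    (M.step c).head = match (M.act c.state (c.tape c.head)).2.2 with
      | none => c.head
      | some .left => c.head - 1
      | some .right => c.head + 1 := by
  unfold step act Config.Halted
  split_ifs
  · rfl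
  · cases h : (M.δ c.state (c.tape c.head)).2.2 <;> simp [h]

theorem step_head_of_move_none {c : M.Config}
    (h : M.move c.state (c.tape c.head) (decide (c.head = 0)) = none) :
    (M.step c).head = c.head := by
  rw [step_head]
  unfold move at h
  split_ifs at h with h1
  · simp only [h1.2]
    have h0 : c.head = 0 := by simpa using h1.1
    rw [h0]
  · simp only [h]

theorem step_head_of_move_right {c : M.Config}
    (h : M.move c.state (c.tape c.head) (decide (c.head = 0)) = some .right) :
    (M.step c).head = c.head + 1 := by
  rw [step_head]
  unfold move at h
  split_ifs at h with h1
  simp only [h]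

theorem step_head_of_move_left {c : M.Config}
    (h : M.move c.state (c.tape c.head) (decide (c.head = 0)) = some .left) :
    (M.step c).head + 1 = c.head := by
  rw [step_head]
  unfold move at h
  split_ifs at h with h1
  have : c.head ≠ 0 := fun h0 => h1 ⟨by simpa using h0, h⟩
  simp only [h]
  exact Nat.sub_add_cancel (Nat.pos_of_ne_zero this)

variable (M)

/-- The states of the error-finding automaton: a walker together with the distance between the head
and the cell that it observes (`0` if it does not observe a cell). -/
abbrev ErrorState : Type := Walker M.Q M.S × ℕ

/-- The transitions from the states of level `0`, for an input whose first letter (if any) is `x`.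
By `cellFinish`, the states that observe a cell on level `0` or `1` have transitions of their own, so
that they are intensional symbols. -/
inductive BaseRule (x : Option α) :
    M.ErrorState → TraceLetter M.Q M.S → Option M.ErrorState → Prop
  | goalMain : BaseRule x (.goal, 0) .begin (some (.main, 0))
  | goalState : BaseRule x (.goal, 0) .begin (some (.state M.start, 0))
  | goalCell : BaseRule x (.goal, 0) .begin (some (.cell .left (M.symbolOf x) true, 0))
  | mainStep q b z : BaseRule x (.main, 0) (.step q b z) (some (.main, 0))
  | mainBegin : BaseRule x (.main, 0) .begin none
  | mainFinish : BaseRule x (.main, 0) .finish none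
  | stateStep q b z : BaseRule x (.state q, 0) (.step q b z) (some (.state (M.act q b).1, 0))
  | stateError q q' b z (h : q' ≠ q) : BaseRule x (.state q, 0) (.step q' b z) none
  | stateAccept b z : BaseRule x (.state M.accept, 0) (.step M.accept b z) none
  | cellStay d q a z (h : M.move q a z = none) :
      BaseRule x (.cell d a z, 0) (.step q a z) (some (.cell d (M.act q a).2.1 z, 0))
  | cellLeave d d' q a z (h : M.move q a z = some d') :
      BaseRule x (.cell d a z, 0) (.step q a z) (some (.cell d' (M.act q a).2.1 z, 1))
  | cellError d q a z b z' (h : ¬ (b = a ∧ z' = z)) :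
      BaseRule x (.cell d a z, 0) (.step q b z') none
  | cellFinish d a z l (h : l ≤ 1) : BaseRule x (.cell d a z, l) .finish none

/-- The transitions from level `e + 1`, and the transition from the initial state to that level, for
an input whose letter `e + 1` (if any) is `x`. By `finish`, the states of level `e + 2` are
intensional symbols even if `e + 1` is the last level. -/
inductive LevelRule (x : Option α) (e : ℕ) :
    M.ErrorState → TraceLetter M.Q M.S → Option M.ErrorState → Prop
  | goalCell : LevelRule x e (.goal, 0) .begin (some (.cell .left (M.symbolOf x) false, e + 1))
  | stay d a z q b z' (h : M.move q b z' = none) :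
      LevelRule x e (.cell d a z, e + 1) (.step q b z') (some (.cell d a z, e + 1))
  | away d a z q b z' (h : M.move q b z' = some d) :
      LevelRule x e (.cell d a z, e + 1) (.step q b z') (some (.cell d a z, e + 2))
  | toward d d' a z q b z' (h : M.move q b z' = some d') (hd : d' ≠ d) :
      LevelRule x e (.cell d a z, e + 1) (.step q b z') (some (.cell d a z, e))
  | finish d a z : LevelRule x e (.cell d a z, e + 2) .finish none

/-- The transitions of the error-finding automaton for the input `w` and space at most `s`. -/
def ErrorRule (w : List α) (s : ℕ) (p : M.ErrorState) (a : TraceLetter M.Q M.S)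
    (o : Option M.ErrorState) : Prop :=
  M.BaseRule w[0]? p a o ∨ ∃ e < s, M.LevelRule w[e + 1]? e p a o

/-- A head in position `h` is on side `d` of cell `i`, at distance `l`. -/
def Apart : Turing.Dir → ℕ → ℕ → ℕ → Prop
  | .left, h, i, l => i = h + l
  | .right, h, i, l => h = i + l

/-- What a state of the error-finding automaton may keep track of. -/
inductive Tracked
  | main
  | state
  | cell (i : ℕ)

variable {M}

/-- The state `p` holds the correct information on the configuration `c`. -/
inductive Tracks (c : M.Config) : Tracked → M.ErrorState → Prop
  | main : Tracks c .main (.main, 0)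
  | state q (h : q = c.state) : Tracks c .state (.state q, 0)
  | right i l a z (h : c.head = i + l) (ha : a = c.tape i) (hz : z = decide (i = 0)) :
      Tracks c (.cell i) (.cell .right a z, l)
  | left i l a z (h : i = c.head + l) (ha : a = c.tape i) (hz : z = decide (i = 0)) :
      Tracks c (.cell i) (.cell .left a z, l)

variable {w : List α} {s : ℕ}

theorem Tracks.dir {c : M.Config} {i l : ℕ} {d : Turing.Dir} {a : M.S} {z : Bool}
    (ha : a = c.tape i) (hz : z = decide (i = 0))
    (h : Apart d c.head i l) :
    Tracks c (.cell i) (.cell d a z, l) := by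
  cases d
  exacts [.left _ _ _ _ h ha hz, .right _ _ _ _ h ha hz]

theorem init_tape (w : List α) (i : ℕ) : (M.init w).tape i = M.symbolOf w[i]? := by
  cases h : w[i]? <;> simp [init, symbolOf, h]

/-- The automaton starts by choosing what to keep track of. At the start, the head is on cell `0`, to
the left of cell `i` at distance `i`. -/
theorem errorRule_goal_iff {a : TraceLetter M.Q M.S} {o : Option M.ErrorState} :
    M.ErrorRule w s (.goal, 0) a o ↔
      a = .begin ∧ ∃ p, o = some p ∧ ((p = (.main, 0)) ∨ (p = (.state M.start, 0)) ∨
        ∃ i ≤ s, p = (.cell .left ((M.init w).tape i) (decide (i = 0)), i)) := by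
  constructor
  · rintro (h | ⟨e, he, h⟩)
    · cases h
      · exact ⟨rfl, _, rfl, .inl rfl⟩
      · exact ⟨rfl, _, rfl, .inr (.inl rfl)⟩
      · exact ⟨rfl, _, rfl, .inr (.inr ⟨0, Nat.zero_le _, by simp [init_tape]⟩)⟩
    · cases h
      exact ⟨rfl, _, rfl, .inr (.inr ⟨e + 1, he, by simp [init_tape]⟩)⟩
  · rintro ⟨rfl, p, rfl, rfl | rfl | ⟨i, hi, rfl⟩⟩
    · exact .inl .goalMain
    · exact .inl .goalState
    · rw [init_tape]
      cases i with
      | zero => exact .inl .goalCell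
      | succ e => exact .inr ⟨e, hi, .goalCell⟩

/-- How a move of the head changes its distance from a cell. -/
theorem Apart.step {c : M.Config} {i l : ℕ} {d : Turing.Dir} (h : Apart d c.head i l) :
    (M.move c.state (c.tape c.head) (decide (c.head = 0)) = none →
      Apart d (M.step c).head i l) ∧
    (M.move c.state (c.tape c.head) (decide (c.head = 0)) = some d →
      Apart d (M.step c).head i (l + 1)) ∧
    (∀ d' ≠ d, ∀ l', l = l' + 1 →
      M.move c.state (c.tape c.head) (decide (c.head = 0)) = some d' →
      Apart d (M.step c).head i l') := by
  refine ⟨fun hm => ?_, fun hm => ?_, fun d' hd l' hl hm => ?_⟩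
  · rwa [step_head_of_move_none hm]
  · cases d
    · have := step_head_of_move_left hm; simp only [Apart] at h ⊢; omega
    · have := step_head_of_move_right hm; simp only [Apart] at h ⊢; omega
  · cases d <;> cases d' <;> try contradiction
    · have := step_head_of_move_right hm; simp only [Apart] at h ⊢; omega
    · have := step_head_of_move_left hm; simp only [Apart] at h ⊢; omega

theorem Tracks.cell_inv {c : M.Config} {i l : ℕ} {d : Turing.Dir} {a : M.S} {z : Bool}
    (h : Tracks c (.cell i) (.cell d a z, l)) :
    a = c.tape i ∧ z = decide (i = 0) ∧
      Apart d c.head i l := by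
  cases h <;> exact ⟨‹_›, ‹_›, ‹_›⟩

theorem step_tape_of_ne {c : M.Config} {i : ℕ} (h : i ≠ c.head) :
    (M.step c).tape i = c.tape i := by
  rw [step_tape, Function.update_of_ne h]

theorem ne_head_of_dir {c : M.Config} {i l : ℕ} {d : Turing.Dir}
    (h : Apart d c.head i (l + 1)) : i ≠ c.head := by
  cases d <;> simp only [Apart] at h <;> omega

theorem eq_head_of_dir {c : M.Config} {i : ℕ} {d : Turing.Dir}
    (h : Apart d c.head i 0) : i = c.head := by
  cases d <;> simp only [Apart] at h <;> omega

theorem dir_of_eq_head {c : M.Config} {l : ℕ} {d : Turing.Dir} (hl : l = 0) :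
    Apart d c.head c.head l := by
  subst hl
  cases d <;> rfl

/-- On the correct letter, a state with correct information does not find an error and moves to a
state with correct information. -/
theorem Tracks.of_errorRule {c : M.Config} {κ : Tracked} {p : M.ErrorState}
    {o : Option M.ErrorState} (hp : Tracks c κ p) (h : M.ErrorRule w s p c.letter o)
    (hc : c.state ≠ M.accept) : ∃ p', o = some p' ∧ Tracks (M.step c) κ p' := by
  obtain ⟨W, l⟩ := p
  cases κ with
  | main =>
    cases hp
    rcases h with h | ⟨e, -, h⟩ <;> cases h
    exact ⟨_, rfl, .main⟩
  | state =>
    cases hp with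
    | state q hq =>
      subst hq
      rcases h with h | ⟨e, -, h⟩
      · unfold Config.letter at h
        generalize hq : c.state = q at h hc
        cases h with
        | stateStep => exact ⟨_, rfl, .state _ (by rw [step_state, hq])⟩
        | stateError _ _ _ _ h => exact absurd rfl h
        | stateAccept => exact absurd rfl hc
      · cases h
  | cell i =>
    obtain ⟨d, a, z, rfl⟩ : ∃ d a z, W = .cell d a z := by cases hp <;> exact ⟨_, _, _, rfl⟩
    obtain ⟨ha, hz, hl⟩ := hp.cell_inv
    obtain ⟨h0, h1, h2⟩ := hl.step
    unfold Config.letter at h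
    rcases h with h | ⟨e, -, h⟩
    · generalize hq : c.state = q at h hc
      generalize hb : c.tape c.head = b at h
      generalize hz' : decide (c.head = 0) = z' at h
      cases h with
      | cellStay _ _ _ _ h =>
        obtain rfl := eq_head_of_dir hl
        subst hq ha hz
        exact ⟨_, rfl, .dir (by simp [step_tape]) rfl (h0 h)⟩
      | cellLeave _ d' _ _ _ h =>
        obtain rfl := eq_head_of_dir hl
        subst hq ha hz
        exact ⟨_, rfl, .dir (by simp [step_tape]) rfl
          ((dir_of_eq_head rfl).step.2.1 h)⟩
      | cellError _ _ _ _ _ _ h =>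
        obtain rfl := eq_head_of_dir hl
        exact absurd ⟨hb.symm.trans ha.symm, hz'.symm.trans hz.symm⟩ h
    · cases h with
      | stay _ _ _ _ _ _ h =>
        exact ⟨_, rfl, .dir (ha.trans (step_tape_of_ne (ne_head_of_dir hl)).symm) hz (h0 h)⟩
      | away _ _ _ _ _ _ h =>
        exact ⟨_, rfl, .dir (ha.trans (step_tape_of_ne (ne_head_of_dir hl)).symm) hz (h1 h)⟩
      | toward _ d' _ _ _ _ _ h hd =>
        exact ⟨_, rfl, .dir (ha.trans (step_tape_of_ne (ne_head_of_dir hl)).symm) hz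
          (h2 d' hd e rfl h)⟩

/-- On the correct letter, a state with correct information can move on. -/
theorem Tracks.exists_errorRule {c : M.Config} {κ : Tracked} {p : M.ErrorState}
    (hp : Tracks c κ p) (hs : c.head ≤ s) (hκ : ∀ i, κ = .cell i → i ≤ s) :
    ∃ p', M.ErrorRule w s p c.letter (some p') := by
  obtain ⟨W, l⟩ := p
  cases κ with
  | main => cases hp; exact ⟨_, .inl (.mainStep _ _ _)⟩
  | state =>
    cases hp with
    | state q hq => subst hq; exact ⟨_, .inl (.stateStep _ _ _)⟩
  | cell i =>
    obtain ⟨d, a, z, rfl⟩ : ∃ d a z, W = .cell d a z := by cases hp <;> exact ⟨_, _, _, rfl⟩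
    obtain ⟨ha, hz, hl⟩ := hp.cell_inv
    have hi := hκ i rfl
    cases l with
    | zero =>
      obtain rfl := eq_head_of_dir hl
      subst ha hz
      rcases hm : M.move c.state (c.tape c.head) (decide (c.head = 0)) with _ | d'
      · exact ⟨_, .inl (.cellStay _ _ _ _ hm)⟩
      · exact ⟨_, .inl (.cellLeave _ _ _ _ _ hm)⟩
    | succ e =>
      have he : e < s := by cases d <;> simp only [Apart] at hl <;> omega
      rcases hm : M.move c.state (c.tape c.head) (decide (c.head = 0)) with _ | d'
      · exact ⟨_, .inr ⟨e, he, .stay _ _ _ _ _ _ hm⟩⟩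
      · by_cases hd : d' = d
        · subst hd; exact ⟨_, .inr ⟨e, he, .away _ _ _ _ _ _ hm⟩⟩
        · exact ⟨_, .inr ⟨e, he, .toward _ _ _ _ _ _ _ hm hd⟩⟩

/-- On a wrong letter, the states that keep track of the right thing find an error. -/
theorem exists_tracked_of_ne_letter {c : M.Config} (hs : c.head ≤ s) {a : TraceLetter M.Q M.S}
    (ha : a ≠ c.letter) : ∃ κ : Tracked, (∀ i, κ = .cell i → i ≤ s) ∧
      ∀ p, Tracks c κ p → M.ErrorRule w s p a none := by
  cases a with
  | begin =>
    exact ⟨.main, by simp, fun p hp => by cases hp; exact .inl .mainBegin⟩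
  | finish =>
    exact ⟨.main, by simp, fun p hp => by cases hp; exact .inl .mainFinish⟩
  | step q b z =>
    by_cases hq : q = c.state
    · refine ⟨.cell c.head, by simpa using hs, fun p hp => .inl ?_⟩
      have key : ¬ (b = c.tape c.head ∧ z = decide (c.head = 0)) := by
        rintro ⟨rfl, rfl⟩
        exact ha (by rw [hq, Config.letter])
      cases hp with
      | right _ l a' z' h ha' hz' =>
        obtain rfl : l = 0 := by omega
        subst ha' hz'
        exact .cellError _ _ _ _ _ _ key
      | left _ l a' z' h ha' hz' =>
        obtain rfl : l = 0 := by omega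
        subst ha' hz'
        exact .cellError _ _ _ _ _ _ key
    · refine ⟨.state, by simp, fun p hp => .inl ?_⟩
      cases hp with
      | state _ h => exact .stateError _ _ _ _ (by rw [h]; exact hq)

/-- If the machine accepts from `c` within `t` steps, then every word of length more than `t`
contains an error, or reaches the accepting state, in its first `t + 1` letters. -/
theorem exists_tracked_of_accept (t : ℕ) {c : M.Config} (hs : ∀ n, (M.step^[n] c).head ≤ s)
    (hc : (M.step^[t] c).state = M.accept) {u : List (TraceLetter M.Q M.S)} (hu : t < u.length) :
    ∃ κ : Tracked, (∀ i, κ = .cell i → i ≤ s) ∧ ∀ p, Tracks c κ p →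
      ∃ v, v <+: u ∧ v.length ≤ t + 1 ∧ Accepts (M.ErrorRule w s) p v := by
  induction t generalizing c u with
  | zero =>
    obtain _ | ⟨a, u⟩ := u
    · simp at hu
    have hsuff : ∃ κ : Tracked, (∀ i, κ = .cell i → i ≤ s) ∧
        ∀ p, Tracks c κ p → M.ErrorRule w s p a none := by
      by_cases ha : a = c.letter
      · refine ⟨.state, by simp, fun p hp => .inl ?_⟩
        cases hp with
        | state q h =>
          subst h ha
          rw [Config.letter, show c.state = M.accept from hc]
          exact .stateAccept _ _
      · exact exists_tracked_of_ne_letter (hs 0) ha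
    obtain ⟨κ, hκ, h⟩ := hsuff
    exact ⟨κ, hκ, fun p hp => ⟨[a], by simp, by simp, .last (h p hp)⟩⟩
  | succ t ih =>
    obtain _ | ⟨a, u⟩ := u
    · simp at hu
    by_cases ha : a = c.letter
    · by_cases hacc : c.state = M.accept
      · refine ⟨.state, by simp, fun p hp => ⟨[a], by simp, by simp, .last (.inl ?_)⟩⟩
        cases hp with
        | state q h =>
          subst h ha
          rw [Config.letter, hacc]
          exact .stateAccept _ _
      obtain ⟨κ, hκ, h⟩ := ih (c := M.step c) (u := u) (fun n => hs (n + 1)) hc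
        (by simpa using hu)
      refine ⟨κ, hκ, fun p hp => ?_⟩
      obtain ⟨p', hR⟩ := hp.exists_errorRule (w := w) (hs 0) hκ
      obtain ⟨p'', he, hp'⟩ := hp.of_errorRule hR hacc
      obtain rfl : p' = p'' := by simpa using he
      obtain ⟨v, hv, hl, hv'⟩ := h p' hp'
      exact ⟨a :: v, by simpa using hv, by simpa using hl, .cons (ha ▸ hR) hv'⟩
    · obtain ⟨κ, hκ, h⟩ := exists_tracked_of_ne_letter (w := w) (hs 0) ha
      exact ⟨κ, hκ, fun p hp => ⟨[a], by simp, by simp, .last (h p hp)⟩⟩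

/-- The word that describes `k` steps of the computation from `c`. -/
noncomputable def trace (c : M.Config) : ℕ → List (TraceLetter M.Q M.S)
  | 0 => []
  | k + 1 => c.letter :: trace (M.step c) k

theorem length_trace (c : M.Config) (k : ℕ) : (trace c k).length = k := by
  induction k generalizing c with
  | zero => rfl
  | succ k ih => simp [trace, ih]

/-- There is no error in a computation that does not accept. -/
theorem Tracks.not_accepts_of_prefix_trace {k : ℕ} {c : M.Config} {κ : Tracked}
    {p : M.ErrorState} (hp : Tracks c κ p) (hc : ∀ n, (M.step^[n] c).state ≠ M.accept)
    {u : List (TraceLetter M.Q M.S)} (hu : u <+: trace c k) :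
    ¬ Accepts (M.ErrorRule w s) p u := by
  induction k generalizing c p u with
  | zero =>
    intro h
    cases h <;> simp [trace] at hu
  | succ k ih =>
    intro h
    cases h with
    | last h =>
      obtain ⟨rfl, -⟩ := List.cons_prefix_cons.1 hu
      obtain ⟨p', h1, -⟩ := hp.of_errorRule h (hc 0)
      simp at h1
    | cons h h' =>
      obtain ⟨rfl, hu'⟩ := List.cons_prefix_cons.1 hu
      obtain ⟨p', h1, hp'⟩ := hp.of_errorRule h (hc 0)
      obtain rfl : _ = p' := by simpa using h1
      exact ih hp' (fun n => hc (n + 1)) hu' h'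

/-- The automaton may wait for the end of a computation. -/
theorem accepts_main_trace (c : M.Config) (k : ℕ) :
    Accepts (M.ErrorRule w s) (.main, 0) (trace c k ++ [.finish]) := by
  induction k generalizing c with
  | zero => exact .last (.inl .mainFinish)
  | succ k ih => exact .cons (.inl (.mainStep _ _ _)) (ih _)

/-- The error-finding automaton is prefix bounded iff the machine accepts. -/
theorem prefixBounded_errorRule_iff (hs : ∀ n, (M.run w n).head ≤ s) :
    PrefixBounded (M.ErrorRule w s) (.goal, 0) ↔ ∃ t, (M.run w t).state = M.accept := by
  constructor
  · rintro ⟨k, hk⟩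
    by_contra! hacc
    obtain ⟨v, hv, hl, hv'⟩ := hk (.begin :: (trace (M.init w) k ++ [.finish]))
      (.cons (.inl .goalMain) (accepts_main_trace _ _))
    cases hv' with
    | last h =>
      obtain ⟨-, p, h, -⟩ := errorRule_goal_iff.1 h
      simp at h
    | @cons _ a q u h hq =>
      obtain ⟨-, hu⟩ := List.cons_prefix_cons.1 hv
      -- The prefix is too short to contain the final letter.
      have hu' : u <+: trace (M.init w) k := by
        refine List.prefix_of_prefix_length_le hu (List.prefix_append _ _) ?_
        rw [length_trace]
        simp at hl
        omega
      obtain ⟨-, p, h, hp⟩ := errorRule_goal_iff.1 h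
      obtain rfl : q = p := by simpa using h
      rcases hp with rfl | rfl | ⟨i, -, rfl⟩
      · exact Tracks.main.not_accepts_of_prefix_trace hacc hu' hq
      · exact (Tracks.state _ rfl).not_accepts_of_prefix_trace hacc hu' hq
      · exact (Tracks.left i i _ _ (by simp [init]) rfl rfl).not_accepts_of_prefix_trace hacc hu' hq
  · rintro ⟨t, ht⟩
    refine ⟨t + 2, fun u hu => ?_⟩
    by_cases hlen : u.length ≤ t + 2
    · exact ⟨u, List.prefix_refl u, hlen, hu⟩
    cases hu with
    | last => simp at hlen
    | @cons _ a q u h hq =>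
      obtain ⟨rfl, -⟩ := errorRule_goal_iff.1 h
      obtain ⟨κ, hκ, hacc⟩ := exists_tracked_of_accept (w := w) t (c := M.init w) hs ht (u := u)
        (by simp at hlen; omega)
      obtain ⟨p, hp, hp'⟩ : ∃ p, M.ErrorRule w s (.goal, 0) .begin (some p) ∧
          Tracks (M.init w) κ p := by
        cases κ with
        | main => exact ⟨_, errorRule_goal_iff.2 ⟨rfl, _, rfl, .inl rfl⟩, .main⟩
        | state => exact ⟨_, errorRule_goal_iff.2 ⟨rfl, _, rfl, .inr (.inl rfl)⟩, .state _ rfl⟩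
        | cell i =>
          exact ⟨_, errorRule_goal_iff.2 ⟨rfl, _, rfl, .inr (.inr ⟨i, hκ i rfl, rfl⟩)⟩,
            .left _ _ _ _ (by simp [init]) rfl rfl⟩
      obtain ⟨v, hv, hl, hv'⟩ := hacc p hp'
      exact ⟨.begin :: v, by simpa using hv, by simpa using hl, .cons hp hv'⟩

/-- Every state that a transition leads to has a transition of its own, so it is an intensional
symbol of the query. -/
theorem exists_errorRule_of_target {p q : M.ErrorState} {a : TraceLetter M.Q M.S}
    (h : M.ErrorRule w s p a (some q)) : ∃ a' o, M.ErrorRule w s q a' o := by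
  have hstate : ∀ q, ∃ a' o, M.ErrorRule w s (.state q, 0) a' o := fun q =>
    ⟨.step q M.blank true, _, .inl (.stateStep _ _ _)⟩
  have hcell : ∀ d a z l, l ≤ s + 1 → ∃ a' o, M.ErrorRule w s (.cell d a z, l) a' o := by
    intro d a z l hl
    by_cases hl1 : l ≤ 1
    · exact ⟨.finish, _, .inl (.cellFinish _ _ _ _ hl1)⟩
    · obtain ⟨e, rfl⟩ : ∃ e, l = e + 2 := ⟨l - 2, by omega⟩
      exact ⟨.finish, _, .inr ⟨e, by omega, .finish _ _ _⟩⟩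
  rcases h with h | ⟨e, he, h⟩
  · cases h
    · exact ⟨_, _, .inl .mainFinish⟩
    · exact hstate _
    · exact hcell _ _ _ _ (by omega)
    · exact ⟨_, _, .inl .mainFinish⟩
    · exact hstate _
    · exact hcell _ _ _ _ (by omega)
    · exact hcell _ _ _ _ (by omega)
  · cases h <;> exact hcell _ _ _ _ (by omega)

end TapeMachine

/-! ### Structured programs on stacks -/

/-- Structured programs that work on stacks with symbols from `Γ k` on stack `k`. -/
inductive StackProgram {K : Type} (Γ : K → Type) : Type
  | skip
  | push (k : K) (a : Γ k)
  | seq (p q : StackProgram Γ)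
  /-- pops a symbol from stack `k` and runs `q a` if it is `a`, or `p` if the stack is empty -/
  | popCase (k : K) (p : StackProgram Γ) (q : Γ k → StackProgram Γ)
  /-- pops symbols from stack `k` and runs `q a` for each symbol `a`, until the stack is empty -/
  | popLoop (k : K) (q : Γ k → StackProgram Γ)

namespace StackProgram

open Turing.TM2.Stmt

variable {K : Type} {Γ : K → Type}

/-- The labels of the compiled program. -/
def Label : StackProgram Γ → Type
  | skip => Unit
  | push _ _ => Unit
  | seq p q => p.Label ⊕ q.Label
  | popCase k p q => Option (p.Label ⊕ (Σ a : Γ k, (q a).Label))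
  | popLoop k q => Option (Σ a : Γ k, (q a).Label)

theorem finite_label [∀ k, Finite (Γ k)] (p : StackProgram Γ) : Finite p.Label := by
  induction p with
  | skip => exact inferInstanceAs (Finite Unit)
  | push => exact inferInstanceAs (Finite Unit)
  | seq p q hp hq => exact inferInstanceAs (Finite (p.Label ⊕ q.Label))
  | popCase k p q hp hq =>
    exact inferInstanceAs (Finite (Option (p.Label ⊕ (Σ a : Γ k, (q a).Label))))
  | popLoop k q hq => exact inferInstanceAs (Finite (Option (Σ a : Γ k, (q a).Label)))

/-- The label where the compiled program starts. -/
def entry : (p : StackProgram Γ) → p.Label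
  | skip => ()
  | push _ _ => ()
  | seq p _ => .inl p.entry
  | popCase _ _ _ => none
  | popLoop _ _ => none

/-- The internal state of the compiled program: the symbols popped last. -/
abbrev Memory (Γ : K → Type) : Type := ∀ k, Option (Γ k)

variable [DecidableEq K]

/-- The compiled program. Its labels are embedded into the labels of a larger machine by `emb`, and
it jumps to the label `exit` when it is done. -/
def code {Λ : Type} : (p : StackProgram Γ) → (p.Label → Λ) → Λ → p.Label →
    Turing.TM2.Stmt Γ Λ (Memory Γ)
  | skip, _, exit, _ => goto fun _ => exit
  | push k a, _, exit, _ => .push k (fun _ => a) (goto fun _ => exit)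
  | seq p q, emb, _, .inl l => p.code (fun l => emb (.inl l)) (emb (.inr q.entry)) l
  | seq _ q, emb, exit, .inr l => q.code (fun l => emb (.inr l)) exit l
  | popCase k p q, emb, _, none =>
    pop k (fun v x => Function.update v k x) (goto fun v => match v k with
      | none => emb (some (.inl p.entry))
      | some a => emb (some (.inr ⟨a, (q a).entry⟩)))
  | popCase _ p _, emb, exit, some (.inl l) => p.code (fun l => emb (some (.inl l))) exit l
  | popCase _ _ q, emb, exit, some (.inr ⟨a, l⟩) =>
    (q a).code (fun l => emb (some (.inr ⟨a, l⟩))) exit l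
  | popLoop k q, emb, exit, none =>
    pop k (fun v x => Function.update v k x) (goto fun v => match v k with
      | none => exit
      | some a => emb (some ⟨a, (q a).entry⟩))
  | popLoop _ q, emb, _, some ⟨a, l⟩ =>
    (q a).code (fun l => emb (some ⟨a, l⟩)) (emb none) l

/-- `Exec p S S' t`: the program `p` transforms the stacks `S` into `S'` in at most `t` steps. -/
inductive Exec : StackProgram Γ → (∀ k, List (Γ k)) → (∀ k, List (Γ k)) → ℕ → Prop
  | skip {S} : Exec skip S S 1
  | push {k a S} : Exec (push k a) S (Function.update S k (a :: S k)) 1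
  | seq {p q S S' S'' t t'} : Exec p S S' t → Exec q S' S'' t' → Exec (seq p q) S S'' (t + t')
  | popCaseNone {k p q S S' t} : S k = [] → Exec p S S' t → Exec (popCase k p q) S S' (t + 1)
  | popCaseSome {k p q S S' t a r} : S k = a :: r → Exec (q a) (Function.update S k r) S' t →
      Exec (popCase k p q) S S' (t + 1)
  | popLoopNil {k q S} : S k = [] → Exec (popLoop k q) S S 1
  | popLoopCons {k q S S' S'' t t' a r} : S k = a :: r →
      Exec (q a) (Function.update S k r) S' t → Exec (popLoop k q) S' S'' t' →
      Exec (popLoop k q) S S'' (t + t' + 1)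
  | mono {p S S' t t'} : Exec p S S' t → t ≤ t' → Exec p S S' t'

/-- The machine goes from `c` to `c'` in at most `t` steps. -/
def StepsWithin {Λ σ : Type} (m : Λ → Turing.TM2.Stmt Γ Λ σ) (t : ℕ)
    (c c' : Turing.TM2.Cfg Γ Λ σ) : Prop :=
  ∃ n ≤ t, (flip bind (Turing.TM2.step m))^[n] (some c) = some c'

namespace StepsWithin

variable {Λ σ : Type} {m : Λ → Turing.TM2.Stmt Γ Λ σ} {c c' c'' : Turing.TM2.Cfg Γ Λ σ} {t t' : ℕ}

theorem single (h : Turing.TM2.step m c = some c') : StepsWithin m 1 c c' := ⟨1, le_rfl, h⟩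

theorem trans (h : StepsWithin m t c c') (h' : StepsWithin m t' c' c'') :
    StepsWithin m (t + t') c c'' := by
  obtain ⟨n, hn, h⟩ := h
  obtain ⟨n', hn', h'⟩ := h'
  exact ⟨n' + n, by omega, by rw [Function.iterate_add_apply, h, h']⟩

theorem mono (h : StepsWithin m t c c') (ht : t ≤ t') : StepsWithin m t' c c' := by
  obtain ⟨n, hn, h⟩ := h
  exact ⟨n, hn.trans ht, h⟩

end StepsWithin

/-- The compiled program does what the program does. -/
theorem Exec.stepsWithin {p : StackProgram Γ} {S S' : ∀ k, List (Γ k)} {t : ℕ}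
    (h : Exec p S S' t) {Λ : Type} {m : Λ → Turing.TM2.Stmt Γ Λ (Memory Γ)}
    {emb : p.Label → Λ} {exit : Λ} (hm : ∀ l, m (emb l) = p.code emb exit l) (v : Memory Γ) :
    ∃ v', StepsWithin m t ⟨some (emb p.entry), v, S⟩ ⟨some exit, v', S'⟩ := by
  induction h generalizing exit v with
  | skip => exact ⟨v, .single (by rw [Turing.TM2.step, hm]; rfl)⟩
  | push => exact ⟨v, .single (by rw [Turing.TM2.step, hm]; rfl)⟩
  | @seq p q _ _ _ _ _ _ _ ihp ihq =>
    obtain ⟨v', h1⟩ := ihp (emb := fun l => emb (.inl l)) (exit := emb (.inr q.entry))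
      (fun l => hm (.inl l)) v
    obtain ⟨v'', h2⟩ := ihq (emb := fun l => emb (.inr l)) (exit := exit)
      (fun l => hm (.inr l)) v'
    exact ⟨v'', h1.trans h2⟩
  | @popCaseNone k p q S _ _ hk _ ih =>
    obtain ⟨v', h1⟩ := ih (emb := fun l => emb (some (.inl l))) (exit := exit)
      (fun l => hm (some (.inl l))) (Function.update v k none)
    refine ⟨v', (StepsWithin.trans (.single ?_) h1).mono (Nat.add_comm _ _).le⟩
    rw [Turing.TM2.step, entry, hm none]
    simp [code, hk, Function.update_eq_self_iff]
  | @popCaseSome k p q S _ _ a r hk _ ih =>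
    obtain ⟨v', h1⟩ := ih (emb := fun l => emb (some (.inr ⟨a, l⟩))) (exit := exit)
      (fun l => hm (some (.inr ⟨a, l⟩))) (Function.update v k (some a))
    refine ⟨v', (StepsWithin.trans (.single ?_) h1).mono (Nat.add_comm _ _).le⟩
    rw [Turing.TM2.step, entry, hm none]
    simp [code, hk]
  | @popLoopNil k q S hk =>
    refine ⟨Function.update v k none, .single ?_⟩
    rw [Turing.TM2.step, entry, hm none]
    simp [code, hk, Function.update_eq_self_iff]
  | @popLoopCons k q S S' S'' t t' a r hk _ _ ihb ihl =>
    obtain ⟨v', h1⟩ := ihb (emb := fun l => emb (some ⟨a, l⟩)) (exit := emb none)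
      (fun l => hm (some ⟨a, l⟩)) (Function.update v k (some a))
    obtain ⟨v'', h2⟩ := ihl (emb := emb) (exit := exit) hm v'
    refine ⟨v'', (StepsWithin.trans (.single ?_) (h1.trans h2)).mono (Nat.add_comm _ _).le⟩
    rw [Turing.TM2.step, entry, hm none]
    simp [code, hk]
  | mono _ ht ih =>
    obtain ⟨v', h⟩ := ih hm v
    exact ⟨v', h.mono ht⟩

/-- The machine that runs a program and halts. -/
noncomputable def machine [Fintype K] [∀ k, Fintype (Γ k)] (p : StackProgram Γ) (k₀ k₁ : K) :
    Turing.FinTM2 :=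
  letI : Fintype (Option p.Label) :=
    letI := p.finite_label
    Fintype.ofFinite _
  { K := K
    k₀ := k₀
    k₁ := k₁
    Γ := Γ
    Λ := Option p.Label
    main := some p.entry
    σ := Memory Γ
    initialState := fun _ => none
    m := fun l => match l with
      | some l => p.code some none l
      | none => load (fun _ _ => none) halt }

/-- A program that turns the input stack, all other stacks being empty, into the output stack in
polynomial time gives a polynomial-time computation. -/
theorem nonempty_computable [Fintype K] [∀ k, Fintype (Γ k)] (p : StackProgram Γ) (k₀ k₁ : K)
    {β : Type} {eb : β → List (Γ k₁)} {f : List (Γ k₀) → β} (T : Polynomial ℕ)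
    (h : ∀ w : List (Γ k₀), Exec p (Function.update (fun _ => []) k₀ w)
      (Function.update (fun _ => []) k₁ (eb (f w))) (T.eval w.length)) :
    Nonempty (Turing.TM2ComputableInPolyTime (id : List (Γ k₀) → List (Γ k₀)) eb f) := by
  refine ⟨⟨⟨p.machine k₀ k₁, Equiv.refl _, Equiv.refl _⟩, T + 1, fun w => ?_⟩⟩
  have key : StepsWithin (p.machine k₀ k₁).m (T.eval w.length + 1)
      ⟨some (some p.entry), fun _ => none, Function.update (fun _ => []) k₀ w⟩
      ⟨none, fun _ => none, Function.update (fun _ => []) k₁ (eb (f w))⟩ := by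
    obtain ⟨v', h1⟩ := (h w).stepsWithin (m := (p.machine k₀ k₁).m) (emb := some) (exit := none)
      (fun _ => rfl) (fun _ => none)
    exact h1.trans (.single rfl)
  have hstk : ∀ (k : K) (l : List (Γ k)), (fun k' => @dite (List (Γ k')) (k' = k) _
      (fun h => by rw [h]; exact l) fun _ => []) = Function.update (fun _ => []) k l := by
    intro k l
    funext k'
    by_cases hk : k' = k
    · subst hk; simp
    · simp [hk]
  have hinit : Turing.initList (p.machine k₀ k₁) w =
      ⟨some (some p.entry), fun _ => none, Function.update (fun _ => []) k₀ w⟩ :=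
    congrArg (Turing.TM2.Cfg.mk (some (some p.entry)) fun _ => none) (hstk k₀ w)
  have hhalt : Turing.haltList (p.machine k₀ k₁) (eb (f w)) =
      ⟨none, fun _ => none, Function.update (fun _ => []) k₁ (eb (f w))⟩ :=
    congrArg (Turing.TM2.Cfg.mk none fun _ => none) (hstk k₁ (eb (f w)))
  have h2 : ∃ n ≤ (T + 1).eval w.length,
      (flip bind (p.machine k₀ k₁).step)^[n] (some (Turing.initList (p.machine k₀ k₁) w)) =
        some (Turing.haltList (p.machine k₀ k₁) (eb (f w))) := by
    rw [hinit, hhalt, Polynomial.eval_add, Polynomial.eval_one]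
    exact key
  have e1 : List.map (Equiv.refl ((p.machine k₀ k₁).Γ (p.machine k₀ k₁).k₀)).invFun (id w) = w :=
    List.map_id w
  have e2 : List.map (Equiv.refl ((p.machine k₀ k₁).Γ (p.machine k₀ k₁).k₁)).invFun (eb (f w)) =
      eb (f w) := List.map_id _
  have h3 : ∃ n ≤ (T + 1).eval w.length, (flip bind (p.machine k₀ k₁).step)^[n]
      (some (Turing.initList (p.machine k₀ k₁)
        (List.map (Equiv.refl ((p.machine k₀ k₁).Γ (p.machine k₀ k₁).k₀)).invFun (id w)))) =
      Option.map (Turing.haltList (p.machine k₀ k₁)) (some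
        (List.map (Equiv.refl ((p.machine k₀ k₁).Γ (p.machine k₀ k₁).k₁)).invFun (eb (f w)))) := by
    rw [e1, e2]; exact h2
  exact ⟨⟨h3.choose, h3.choose_spec.2⟩, h3.choose_spec.1⟩

end StackProgram

/-! ### The query of a computation -/

theorem finite_walker {Q S : Type} [Finite Q] [Finite S] : Finite (Walker Q S) := by
  have : Finite Turing.Dir :=
    Finite.of_surjective (fun b : Bool => if b then Turing.Dir.right else Turing.Dir.left) (by
      rintro (_ | _)
      exacts [⟨false, rfl⟩, ⟨true, rfl⟩])
  refine Finite.of_surjective (α := Unit ⊕ Unit ⊕ Q ⊕ (Turing.Dir × S × Bool)) (fun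
    | .inl _ => .goal
    | .inr (.inl _) => .main
    | .inr (.inr (.inl q)) => .state q
    | .inr (.inr (.inr t)) => .cell t.1 t.2.1 t.2.2) ?_
  rintro (_ | _ | q | ⟨d, a, z⟩)
  exacts [⟨.inl (), rfl⟩, ⟨.inr (.inl ()), rfl⟩, ⟨.inr (.inr (.inl q)), rfl⟩,
    ⟨.inr (.inr (.inr (d, a, z))), rfl⟩]

theorem finite_traceLetter {Q S : Type} [Finite Q] [Finite S] : Finite (TraceLetter Q S) := by
  refine Finite.of_surjective (α := Unit ⊕ Unit ⊕ (Q × S × Bool)) (fun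
    | .inl _ => .begin
    | .inr (.inl _) => .finish
    | .inr (.inr t) => .step t.1 t.2.1 t.2.2) ?_
  rintro (_ | _ | ⟨q, b, z⟩)
  exacts [⟨.inl (), rfl⟩, ⟨.inr (.inl ()), rfl⟩, ⟨.inr (.inr (q, b, z)), rfl⟩]

/-- The tokens of a rule, in which `none` stands for a number of ticks that is to be chosen. -/
abbrev TokenTemplate : Type := List (Option Token)

/-- Choose `n` ticks for every `none`. -/
def TokenTemplate.expand (n : ℕ) (l : TokenTemplate) : List Token :=
  l.flatMap fun
    | none => List.replicate n .tick
    | some t => [t]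

theorem TokenTemplate.expand_append (n : ℕ) (l l' : TokenTemplate) :
    expand n (l ++ l') = expand n l ++ expand n l' := by
  simp [expand]

theorem TokenTemplate.expand_map_some (n : ℕ) (l : List Token) : expand n (l.map some) = l := by
  simp [expand, List.flatMap_map]

namespace TapeMachine

variable {α : Type} (M : TapeMachine α)

instance : Finite M.Q := letI := M.finQ; inferInstance

instance : Finite M.S := letI := M.finS; inferInstance

instance : Finite (Walker M.Q M.S) := finite_walker

instance : Finite (TraceLetter M.Q M.S) := finite_traceLetter

/-- The number of walkers. -/
noncomputable def walkerCard : ℕ := Nat.card (Walker M.Q M.S)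

/-- An enumeration of the walkers. -/
noncomputable def walkerIndex (x : Walker M.Q M.S) : ℕ := Finite.equivFin _ x

/-- The name of a state of the error-finding automaton. Raising the level by `e` adds
`walkerCard * e` ticks to the name. -/
noncomputable def stateName (p : M.ErrorState) : ℕ := M.walkerIndex p.1 + M.walkerCard * p.2

/-- The name of a letter. -/
noncomputable def letterName (a : TraceLetter M.Q M.S) : ℕ := Finite.equivFin _ a

theorem walkerIndex_lt (x : Walker M.Q M.S) : M.walkerIndex x < M.walkerCard :=
  (Finite.equivFin _ x).2

theorem stateName_injective : Function.Injective M.stateName := by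
  rintro ⟨x, l⟩ ⟨y, m⟩ h
  have hx := M.walkerIndex_lt x
  have hy := M.walkerIndex_lt y
  simp only [stateName] at h
  have h1 := congrArg (· % M.walkerCard) h
  have h2 := congrArg (· / M.walkerCard) h
  simp only [Nat.add_mul_mod_self_left, Nat.mod_eq_of_lt hx, Nat.mod_eq_of_lt hy] at h1
  simp only [Nat.add_mul_div_left _ _ (Nat.zero_lt_of_lt hx), Nat.div_eq_of_lt hx,
    Nat.div_eq_of_lt hy, zero_add] at h2
  have h3 : x = y := (Finite.equivFin _).injective (Fin.ext h1)
  rw [h3, h2]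

theorem letterName_injective : Function.Injective M.letterName := fun _ _ h =>
  (Finite.equivFin _).injective (Fin.ext h)

/-- The description of a state whose level depends on a number `e`: a walker, a level, and whether
`e` is to be added to the level. -/
abbrev StateTemplate : Type := Walker M.Q M.S × Fin 3 × Bool

/-- The description of a transition that depends on a number. -/
abbrev TransitionTemplate : Type :=
  M.StateTemplate × TraceLetter M.Q M.S × Option M.StateTemplate

variable {M}

/-- The state given by a description. -/
def StateTemplate.inst (e : ℕ) (r : M.StateTemplate) : M.ErrorState :=
  (r.1, r.2.1 + if r.2.2 then e else 0)

/-- The transition given by a description. -/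
noncomputable def TransitionTemplate.inst (e : ℕ) (t : M.TransitionTemplate) : NatTransition :=
  (M.stateName (t.1.inst e), M.letterName t.2.1,
    t.2.2.map fun r => M.stateName (StateTemplate.inst e r))

variable (M)

/-- The list of all descriptions whose instances for the number `0` are in `BaseRule`. -/
noncomputable def baseTemplates (x : Option α) : List M.TransitionTemplate :=
  {t : M.TransitionTemplate | M.BaseRule x (t.1.inst 0) t.2.1
    (t.2.2.map (StateTemplate.inst 0))}.toFinite.toFinset.toList

/-- The list of all descriptions whose instances for every number `e` are in `LevelRule x e`. -/
noncomputable def levelTemplates (x : Option α) : List M.TransitionTemplate :=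
  {t : M.TransitionTemplate | ∀ e, M.LevelRule x e (t.1.inst e) t.2.1
    (t.2.2.map (StateTemplate.inst e))}.toFinite.toFinset.toList

variable {M}

theorem mem_map_baseTemplates {x : Option α} {u : NatTransition} :
    u ∈ (M.baseTemplates x).map (TransitionTemplate.inst 0) ↔
      ∃ p a o, M.BaseRule x p a o ∧ (M.stateName p, M.letterName a, o.map M.stateName) = u := by
  simp only [baseTemplates, List.mem_map, Finset.mem_toList, Set.Finite.mem_toFinset,
    Set.mem_ofPred_eq]
  constructor
  · rintro ⟨t, ht, rfl⟩
    exact ⟨_, _, _, ht, by simp [TransitionTemplate.inst, Function.comp_def]⟩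
  · rintro ⟨p, a, o, h, rfl⟩
    obtain ⟨t, h1, rfl, h2⟩ : ∃ t : M.TransitionTemplate, t.1.inst 0 = p ∧ t.2.1 = a ∧
        t.2.2.map (StateTemplate.inst 0) = o := by
      have hp : ∀ x l, l ≤ 1 → ∃ r : M.StateTemplate, r.inst 0 = (x, l) := fun x l hl =>
        ⟨(x, ⟨l, by omega⟩, false), rfl⟩
      have key : ∃ r : M.StateTemplate, r.inst 0 = p := by
        cases h <;> exact hp _ _ (by omega)
      obtain ⟨r, hr⟩ := key
      have key' : ∃ r' : Option M.StateTemplate, r'.map (StateTemplate.inst 0) = o := by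
        cases o with
        | none => exact ⟨none, rfl⟩
        | some q =>
          have : ∃ r : M.StateTemplate, r.inst 0 = q := by
            cases h <;> exact hp _ _ (by omega)
          obtain ⟨r', hr'⟩ := this
          exact ⟨some r', by simp [hr']⟩
      obtain ⟨r', hr'⟩ := key'
      exact ⟨(r, a, r'), hr, rfl, hr'⟩
    subst h1 h2
    exact ⟨t, h, by simp [TransitionTemplate.inst, Function.comp_def]⟩

theorem mem_map_levelTemplates {x : Option α} {e : ℕ} {u : NatTransition} :
    u ∈ (M.levelTemplates x).map (TransitionTemplate.inst e) ↔
      ∃ p a o, M.LevelRule x e p a o ∧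
        (M.stateName p, M.letterName a, o.map M.stateName) = u := by
  simp only [levelTemplates, List.mem_map, Finset.mem_toList, Set.Finite.mem_toFinset,
    Set.mem_ofPred_eq]
  constructor
  · rintro ⟨t, ht, rfl⟩
    exact ⟨_, _, _, ht e, by simp [TransitionTemplate.inst, Function.comp_def]⟩
  · rintro ⟨p, a, o, h, rfl⟩
    obtain ⟨t, ht, h1, rfl, h2⟩ : ∃ t : M.TransitionTemplate,
        (∀ e, M.LevelRule x e (t.1.inst e) t.2.1 (t.2.2.map (StateTemplate.inst e))) ∧
        t.1.inst e = p ∧ t.2.1 = a ∧ t.2.2.map (StateTemplate.inst e) = o := by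
      have hl : ∀ i e : ℕ, i + e = e + i := Nat.add_comm
      cases h with
      | goalCell =>
        refine ⟨((.goal, 0, false), .begin, some (.cell .left (M.symbolOf x) false, 1, true)),
          fun e => ?_, rfl, rfl, ?_⟩
        · simpa [StateTemplate.inst, hl] using LevelRule.goalCell
        · simp [StateTemplate.inst, hl]
      | stay d a z q b z' h =>
        refine ⟨((.cell d a z, 1, true), .step q b z', some (.cell d a z, 1, true)),
          fun e => ?_, ?_, rfl, ?_⟩
        · simpa [StateTemplate.inst, hl] using LevelRule.stay d a z q b z' h
        all_goals simp [StateTemplate.inst, hl]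
      | away d a z q b z' h =>
        refine ⟨((.cell d a z, 1, true), .step q b z', some (.cell d a z, 2, true)),
          fun e => ?_, ?_, rfl, ?_⟩
        · simpa [StateTemplate.inst, hl] using LevelRule.away d a z q b z' h
        all_goals simp [StateTemplate.inst, hl]
      | toward d d' a z q b z' h hd =>
        refine ⟨((.cell d a z, 1, true), .step q b z', some (.cell d a z, 0, true)),
          fun e => ?_, ?_, rfl, ?_⟩
        · simpa [StateTemplate.inst, hl] using LevelRule.toward d d' a z q b z' h hd
        all_goals simp [StateTemplate.inst, hl]
      | finish d a z =>
        refine ⟨((.cell d a z, 2, true), .finish, none), fun e => ?_, ?_, rfl, rfl⟩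
        · simpa [StateTemplate.inst, hl] using LevelRule.finish d a z
        all_goals simp [StateTemplate.inst, hl]
    subst h1 h2
    exact ⟨t, ht, by simp [TransitionTemplate.inst, Function.comp_def]⟩

variable (M)

/-- The transitions of the error-finding automaton for the input `w` and space at most `s`. -/
noncomputable def transitions (w : List α) : ℕ → List NatTransition
  | 0 => (M.baseTemplates w[0]?).map (TransitionTemplate.inst 0)
  | e + 1 => (M.levelTemplates w[e + 1]?).map (TransitionTemplate.inst e) ++ transitions w e

variable {M} {w : List α} {s : ℕ}

theorem mem_transitions {u : NatTransition} :
    u ∈ M.transitions w s ↔ ∃ p a o, M.ErrorRule w s p a o ∧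
      (M.stateName p, M.letterName a, o.map M.stateName) = u := by
  induction s with
  | zero => simp [transitions, mem_map_baseTemplates, ErrorRule]
  | succ e ih =>
    rw [transitions, List.mem_append, mem_map_levelTemplates, ih]
    constructor
    · rintro (⟨p, a, o, h, hu⟩ | ⟨p, a, o, h, hu⟩)
      · exact ⟨p, a, o, .inr ⟨e, by omega, h⟩, hu⟩
      · refine ⟨p, a, o, h.imp id ?_, hu⟩
        rintro ⟨e', he, h⟩
        exact ⟨e', by omega, h⟩
    · rintro ⟨p, a, o, h | ⟨e', he, h⟩, hu⟩
      · exact .inr ⟨p, a, o, .inl h, hu⟩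
      · rcases Nat.lt_succ_iff_lt_or_eq.1 he with he | rfl
        · exact .inr ⟨p, a, o, .inr ⟨e', he, h⟩, hu⟩
        · exact .inl ⟨p, a, o, h, hu⟩

theorem exists_transition_of_errorRule {p : M.ErrorState} {a : TraceLetter M.Q M.S}
    {o : Option M.ErrorState} (h : M.ErrorRule w s p a o) :
    ∃ t ∈ M.transitions w s, t.1 = M.stateName p :=
  ⟨_, mem_transitions.2 ⟨p, a, o, h, rfl⟩, rfl⟩

theorem closed_transitions : automatonProgram.Closed (M.transitions w s) := by
  intro p a q h
  obtain ⟨p', a', o', h1, h2⟩ := mem_transitions.1 h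
  simp only [Prod.mk.injEq] at h2
  obtain ⟨q', rfl, rfl⟩ := Option.map_eq_some_iff.1 h2.2.2
  obtain ⟨_, _, h3⟩ := exists_errorRule_of_target h1
  exact exists_transition_of_errorRule h3

variable (M)

/-- The query of the error-finding automaton for the input `w` and space at most `s`. -/
noncomputable def errorQuery (w : List α) (s : ℕ) : CLMQuery :=
  automatonQuery (M.transitions w s) (M.stateName (.goal, 0))
    (exists_transition_of_errorRule (.inl .goalMain))

variable {M}

theorem errorQuery_bounded_iff (hs : ∀ n, (M.run w n).head ≤ s) :
    (M.errorQuery w s).Bounded ↔ ∃ t, (M.run w t).state = M.accept := by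
  rw [errorQuery, automatonQuery_bounded_iff closed_transitions, ← prefixBounded_errorRule_iff hs]
  refine prefixBounded_iff_of_injective M.stateName_injective M.letterName_injective ?_ _
  intro p a o
  simp [automatonProgram.Trans, mem_transitions]

/-! ### Writing down the query -/

/-- The template for the name of a state. The ticks to be chosen are those that come from the level
`e`, so `walkerCard * e` of them are needed. -/
noncomputable def StateTemplate.tokens (r : M.StateTemplate) : TokenTemplate :=
  (if r.2.2 then [none] else []) ++
    (encodeName (M.walkerIndex r.1 + M.walkerCard * r.2.1)).map some

/-- The template for a rule. -/
noncomputable def TransitionTemplate.tokens (t : M.TransitionTemplate) : TokenTemplate :=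
  t.1.tokens ++ (encodeName 0 ++ [Token.atomEnd] ++ encodeName (M.letterName t.2.1) ++ encodeName 0 ++
    encodeName 1 ++ [Token.atomEnd]).map some ++
  (match t.2.2 with
    | none => []
    | some r => StateTemplate.tokens r ++ (encodeName 1 ++ [Token.atomEnd]).map some) ++ [some .ruleEnd]

theorem StateTemplate.expand_tokens (r : M.StateTemplate) (e : ℕ) :
    r.tokens.expand (M.walkerCard * e) = encodeName (M.stateName (r.inst e)) := by
  obtain ⟨x, d, b⟩ := r
  rw [tokens, TokenTemplate.expand_append, TokenTemplate.expand_map_some]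
  cases b
  · simp [TokenTemplate.expand, inst, stateName]
  · simp only [TokenTemplate.expand, inst, stateName, encodeName, if_true, List.flatMap_cons,
      List.flatMap_nil, List.append_nil, ← List.append_assoc, List.replicate_append_replicate]
    congr 2
    ring

theorem TransitionTemplate.expand_tokens (t : M.TransitionTemplate) (e : ℕ) :
    t.tokens.expand (M.walkerCard * e) = (t.inst e).rule.encode := by
  obtain ⟨r, a, o⟩ := t
  have h : TokenTemplate.expand (M.walkerCard * e) [some Token.ruleEnd] = [Token.ruleEnd] := rfl
  cases o with
  | none =>
    simp only [tokens, TokenTemplate.expand_append, TokenTemplate.expand_map_some, h,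
      StateTemplate.expand_tokens]
    simp [NatTransition.rule, DatalogRule.encode, DatalogAtom.encode, inst, TokenTemplate.expand]
  | some q =>
    simp only [tokens, TokenTemplate.expand_append, TokenTemplate.expand_map_some, h,
      StateTemplate.expand_tokens]
    simp [NatTransition.rule, DatalogRule.encode, DatalogAtom.encode, inst]

theorem expand_flatMap_tokens (l : List M.TransitionTemplate) (e : ℕ) :
    TokenTemplate.expand (M.walkerCard * e) (l.flatMap TransitionTemplate.tokens) =
      (l.map (TransitionTemplate.inst e)).flatMap fun t => t.rule.encode := by
  induction l with
  | nil => rfl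
  | cons t l ih =>
    rw [List.flatMap_cons, TokenTemplate.expand_append, ih, TransitionTemplate.expand_tokens,
      List.map_cons, List.flatMap_cons]

theorem errorQuery_encode (w : List α) (s : ℕ) :
    (M.errorQuery w s).encode = encodeName (M.stateName (.goal, 0)) ++
      (M.transitions w s).flatMap fun t => t.rule.encode := by
  simp [CLMQuery.encode, errorQuery, automatonQuery, automatonProgram, List.flatMap_map]

end TapeMachine

/-! ### A program that writes down the query -/

/-- The stacks of the program. -/
inductive Reg
  /-- the input -/
  | inp
  /-- the reversed input, while its length is computed -/
  | sav
  /-- the number of levels that are still to be written -/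
  | lvl
  /-- a partial product -/
  | acc
  /-- the number whose power bounds the space -/
  | base
  /-- the number of ticks by which the names on the current level are shifted -/
  | shift
  /-- a copy of a part of `shift` -/
  | copy
  /-- the output -/
  | out
  deriving DecidableEq

/-- The symbols on the stacks; all stacks except those for the input and the output are
counters. -/
def RegSymbol (α : Type) : Reg → Type
  | .inp => α
  | .sav => α
  | .out => Token
  | _ => Unit

instance : Fintype Reg :=
  ⟨{.inp, .sav, .lvl, .acc, .base, .shift, .copy, .out}, by rintro (_ | _) <;> simp⟩

open Classical in
noncomputable instance : Fintype Token :=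
  ⟨{Token.tick, Token.nameEnd, Token.atomEnd, Token.ruleEnd}, by rintro (_ | _) <;> simp⟩

noncomputable instance {α : Type} [Fintype α] (k : Reg) : Fintype (RegSymbol α k) := by
  cases k <;> dsimp only [RegSymbol] <;> infer_instance

/-- The contents of the stacks. -/
structure Regs (α : Type) where
  inp : List α
  sav : List α
  lvl : ℕ
  acc : ℕ
  base : ℕ
  shift : ℕ
  copy : ℕ
  out : List Token

namespace Regs

variable {α : Type}

/-- The contents of the stacks, as a family of lists. -/
def stk (R : Regs α) : ∀ k, List (RegSymbol α k)
  | .inp => R.inp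
  | .sav => R.sav
  | .lvl => List.replicate R.lvl ()
  | .acc => List.replicate R.acc ()
  | .base => List.replicate R.base ()
  | .shift => List.replicate R.shift ()
  | .copy => List.replicate R.copy ()
  | .out => R.out

variable (R : Regs α)

theorem update_inp (l : List α) :
    Function.update R.stk .inp l = stk { R with inp := l } := by
  funext k; cases k <;> rfl

theorem update_sav (l : List α) :
    Function.update R.stk .sav l = stk { R with sav := l } := by
  funext k; cases k <;> rfl

theorem update_lvl (n : ℕ) :
    Function.update R.stk .lvl (List.replicate n ()) = stk { R with lvl := n } := by
  funext k; cases k <;> rfl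

theorem update_acc (n : ℕ) :
    Function.update R.stk .acc (List.replicate n ()) = stk { R with acc := n } := by
  funext k; cases k <;> rfl

theorem update_base (n : ℕ) :
    Function.update R.stk .base (List.replicate n ()) = stk { R with base := n } := by
  funext k; cases k <;> rfl

theorem update_shift (n : ℕ) :
    Function.update R.stk .shift (List.replicate n ()) = stk { R with shift := n } := by
  funext k; cases k <;> rfl

theorem update_copy (n : ℕ) :
    Function.update R.stk .copy (List.replicate n ()) = stk { R with copy := n } := by
  funext k; cases k <;> rfl

theorem update_out (l : List Token) :
    Function.update R.stk .out l = stk { R with out := l } := by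
  funext k; cases k <;> rfl

end Regs

namespace StackProgram

variable {α : Type}

/-- `p` takes the stacks from `R` to `R'` in at most `t` steps. -/
def Run (p : StackProgram (RegSymbol α)) (R R' : Regs α) (t : ℕ) : Prop := Exec p R.stk R'.stk t

namespace Run

variable {R R' R'' : Regs α} {p q : StackProgram (RegSymbol α)} {t t' : ℕ}

theorem seq (h : Run p R R' t) (h' : Run q R' R'' t') : Run (.seq p q) R R'' (t + t') :=
  Exec.seq h h'

theorem of_eq (h : Run p R R' t) (hR : R' = R'') (ht : t ≤ t') : Run p R R'' t' :=
  hR ▸ Exec.mono h ht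

theorem skip : Run .skip R R 1 := Exec.skip

theorem push_inp (a : α) : Run (.push .inp a) R { R with inp := a :: R.inp } 1 := by
  rw [Run, ← R.update_inp (a :: R.inp)]; exact Exec.push (S := R.stk)

theorem push_sav (a : α) : Run (.push .sav a) R { R with sav := a :: R.sav } 1 := by
  rw [Run, ← R.update_sav (a :: R.sav)]; exact Exec.push (S := R.stk)

theorem push_lvl : Run (.push .lvl ()) R { R with lvl := R.lvl + 1 } 1 := by
  rw [Run, ← R.update_lvl (R.lvl + 1)]; exact Exec.push (S := R.stk)

theorem push_acc : Run (.push .acc ()) R { R with acc := R.acc + 1 } 1 := by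
  rw [Run, ← R.update_acc (R.acc + 1)]; exact Exec.push (S := R.stk)

theorem push_base : Run (.push .base ()) R { R with base := R.base + 1 } 1 := by
  rw [Run, ← R.update_base (R.base + 1)]; exact Exec.push (S := R.stk)

theorem push_shift : Run (.push .shift ()) R { R with shift := R.shift + 1 } 1 := by
  rw [Run, ← R.update_shift (R.shift + 1)]; exact Exec.push (S := R.stk)

theorem push_copy : Run (.push .copy ()) R { R with copy := R.copy + 1 } 1 := by
  rw [Run, ← R.update_copy (R.copy + 1)]; exact Exec.push (S := R.stk)

theorem push_out (a : Token) : Run (.push .out a) R { R with out := a :: R.out } 1 := by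
  rw [Run, ← R.update_out (a :: R.out)]; exact Exec.push (S := R.stk)

theorem loop_nil {k : Reg} {q : RegSymbol α k → StackProgram (RegSymbol α)} (h : R.stk k = []) :
    Run (.popLoop k q) R R 1 := Exec.popLoopNil h

theorem loop_inp {q : α → StackProgram (RegSymbol α)} {a : α} {l : List α} (h : R.inp = a :: l)
    (h1 : Run (q a) { R with inp := l } R' t) (h2 : Run (.popLoop .inp q) R' R'' t') :
    Run (.popLoop .inp q) R R'' (t + t' + 1) := by
  rw [Run, ← R.update_inp] at h1; exact .popLoopCons h h1 h2

theorem loop_sav {q : α → StackProgram (RegSymbol α)} {a : α} {l : List α} (h : R.sav = a :: l)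
    (h1 : Run (q a) { R with sav := l } R' t) (h2 : Run (.popLoop .sav q) R' R'' t') :
    Run (.popLoop .sav q) R R'' (t + t' + 1) := by
  rw [Run, ← R.update_sav] at h1; exact .popLoopCons h h1 h2

theorem loop_lvl {n : ℕ} (h : R.lvl = n + 1) (h1 : Run p { R with lvl := n } R' t)
    (h2 : Run (.popLoop .lvl fun _ => p) R' R'' t') :
    Run (.popLoop .lvl fun _ => p) R R'' (t + t' + 1) := by
  rw [Run, ← R.update_lvl] at h1
  exact .popLoopCons (congrArg (List.replicate · ()) h) h1 h2

theorem loop_acc {n : ℕ} (h : R.acc = n + 1) (h1 : Run p { R with acc := n } R' t)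
    (h2 : Run (.popLoop .acc fun _ => p) R' R'' t') :
    Run (.popLoop .acc fun _ => p) R R'' (t + t' + 1) := by
  rw [Run, ← R.update_acc] at h1
  exact .popLoopCons (congrArg (List.replicate · ()) h) h1 h2

theorem loop_base {n : ℕ} (h : R.base = n + 1) (h1 : Run p { R with base := n } R' t)
    (h2 : Run (.popLoop .base fun _ => p) R' R'' t') :
    Run (.popLoop .base fun _ => p) R R'' (t + t' + 1) := by
  rw [Run, ← R.update_base] at h1
  exact .popLoopCons (congrArg (List.replicate · ()) h) h1 h2

theorem loop_shift {n : ℕ} (h : R.shift = n + 1) (h1 : Run p { R with shift := n } R' t)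
    (h2 : Run (.popLoop .shift fun _ => p) R' R'' t') :
    Run (.popLoop .shift fun _ => p) R R'' (t + t' + 1) := by
  rw [Run, ← R.update_shift] at h1
  exact .popLoopCons (congrArg (List.replicate · ()) h) h1 h2

theorem loop_copy {n : ℕ} (h : R.copy = n + 1) (h1 : Run p { R with copy := n } R' t)
    (h2 : Run (.popLoop .copy fun _ => p) R' R'' t') :
    Run (.popLoop .copy fun _ => p) R R'' (t + t' + 1) := by
  rw [Run, ← R.update_copy] at h1
  exact .popLoopCons (congrArg (List.replicate · ()) h) h1 h2

end Run

/-- Run a program several times. -/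
def times (p : StackProgram (RegSymbol α)) : ℕ → StackProgram (RegSymbol α)
  | 0 => .skip
  | n + 1 => .seq p (p.times n)

/-- Add the length of the input to `base`, and keep the input. -/
def readLength : StackProgram (RegSymbol α) :=
  .seq (.popLoop .inp fun a => .seq (.push .sav a) (.push .base ()))
    (.popLoop .sav fun a => .push .inp a)

theorem run_readLength (w : List α) (l a b e c : ℕ) (o : List Token) :
    Run readLength ⟨w, [], l, a, b, e, c, o⟩ ⟨w, [], l, a, b + w.length, e, c, o⟩
      (5 * w.length + 2) := by
  have h1 : ∀ (u v : List α) (b : ℕ),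
      Run (.popLoop .inp fun a => .seq (.push .sav a) (.push .base ())) ⟨u, v, l, a, b, e, c, o⟩
        ⟨[], u.reverse ++ v, l, a, b + u.length, e, c, o⟩ (3 * u.length + 1) := by
    intro u
    induction u with
    | nil => exact fun v b => .loop_nil rfl
    | cons x u ih =>
      intro v b
      refine (Run.loop_inp rfl (.seq (.push_sav x) .push_base) (ih (x :: v) (b + 1))).of_eq ?_ ?_
      · simp [Nat.add_right_comm, Nat.add_assoc]
      · simp; omega
  have h2 : ∀ (u v : List α) (b : ℕ),
      Run (.popLoop .sav fun a => .push .inp a) ⟨v, u, l, a, b, e, c, o⟩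
        ⟨u.reverse ++ v, [], l, a, b, e, c, o⟩ (2 * u.length + 1) := by
    intro u
    induction u with
    | nil => exact fun v b => .loop_nil rfl
    | cons x u ih =>
      intro v b
      refine (Run.loop_sav rfl (.push_inp x) (ih (x :: v) b)).of_eq ?_ ?_
      · simp
      · simp; omega
  exact ((h1 w [] b).seq (h2 _ _ _)).of_eq (by simp) (by simp; omega)

theorem run_times_push_base (n : ℕ) (u v : List α) (l a b e c : ℕ) (o : List Token) :
    Run (times (.push .base ()) n) ⟨u, v, l, a, b, e, c, o⟩ ⟨u, v, l, a, b + n, e, c, o⟩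
      (n + 1) := by
  induction n generalizing b with
  | zero => exact Exec.skip
  | succ n ih =>
    exact (Run.seq .push_base (ih (b + 1))).of_eq (by congr 1; omega) (by omega)

theorem run_times_push_shift (n : ℕ) (u v : List α) (l a b e c : ℕ) (o : List Token) :
    Run (times (.push .shift ()) n) ⟨u, v, l, a, b, e, c, o⟩ ⟨u, v, l, a, b, e + n, c, o⟩
      (n + 1) := by
  induction n generalizing e with
  | zero => exact Exec.skip
  | succ n ih =>
    exact (Run.seq .push_shift (ih (e + 1))).of_eq (by congr 1; omega) (by omega)

/-- Multiply `lvl` by `base`. -/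
def mulLevel : StackProgram (RegSymbol α) :=
  .seq
    (.popLoop .lvl fun _ => .seq
      (.popLoop .base fun _ => .seq (.push .copy ()) (.push .acc ()))
      (.popLoop .copy fun _ => .push .base ()))
    (.popLoop .acc fun _ => .push .lvl ())

theorem run_mulLevel (u v : List α) (l b e : ℕ) (o : List Token) :
    Run mulLevel ⟨u, v, l, 0, b, e, 0, o⟩ ⟨u, v, l * b, 0, b, e, 0, o⟩
      (l * (7 * b + 3) + 2) := by
  have h1 : ∀ n l a c, Run (.popLoop .base fun _ => .seq (.push .copy ()) (.push .acc ()))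
      ⟨u, v, l, a, n, e, c, o⟩ ⟨u, v, l, a + n, 0, e, c + n, o⟩ (3 * n + 1) := by
    intro n
    induction n with
    | zero => exact fun l a c => .loop_nil rfl
    | succ n ih =>
      intro l a c
      exact (Run.loop_base rfl (.seq .push_copy .push_acc) (ih l (a + 1) (c + 1))).of_eq
        (by congr 1 <;> omega) (by omega)
  have h2 : ∀ n l a b, Run (.popLoop .copy fun _ => .push .base ())
      ⟨u, v, l, a, b, e, n, o⟩ ⟨u, v, l, a, b + n, e, 0, o⟩ (2 * n + 1) := by
    intro n
    induction n with
    | zero => exact fun l a b => .loop_nil rfl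
    | succ n ih =>
      intro l a b
      exact (Run.loop_copy rfl .push_base (ih l a (b + 1))).of_eq (by congr 1; omega) (by omega)
  have h3 : ∀ n l, Run (.popLoop .acc fun _ => .push .lvl ())
      ⟨u, v, l, n, b, e, 0, o⟩ ⟨u, v, l + n, 0, b, e, 0, o⟩ (2 * n + 1) := by
    intro n
    induction n with
    | zero => exact fun l => .loop_nil rfl
    | succ n ih =>
      intro l
      exact (Run.loop_acc rfl .push_lvl (ih (l + 1))).of_eq (by congr 1; omega) (by omega)
  have h4 : ∀ n a, Run (.popLoop .lvl fun _ => .seq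
        (.popLoop .base fun _ => .seq (.push .copy ()) (.push .acc ()))
        (.popLoop .copy fun _ => .push .base ()))
      ⟨u, v, n, a, b, e, 0, o⟩ ⟨u, v, 0, a + n * b, b, e, 0, o⟩ (n * (5 * b + 3) + 1) := by
    intro n
    induction n with
    | zero =>
      intro a
      simp only [Nat.zero_mul, Nat.zero_add, Nat.add_zero]
      exact .loop_nil rfl
    | succ n ih =>
      intro a
      have h := (h1 b n a 0).seq (h2 (0 + b) n (a + b) 0)
      simp only [Nat.zero_add] at h
      refine (Run.loop_lvl (R := ⟨u, v, n + 1, a, b, e, 0, o⟩) rfl h (ih (a + b))).of_eq ?_ ?_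
      · congr 1; ring
      · rw [Nat.succ_mul n]; omega
  refine ((h4 l 0).seq (h3 _ 0)).of_eq (by simp) ?_
  rw [Nat.zero_add]
  exact le_of_eq (by ring)

theorem run_times_mulLevel (k : ℕ) (u v : List α) (l b e : ℕ) (o : List Token) (hb : 1 ≤ b) :
    Run (times mulLevel k) ⟨u, v, l, 0, b, e, 0, o⟩ ⟨u, v, l * b ^ k, 0, b, e, 0, o⟩
      (k * (l * b ^ k * (7 * b + 3) + 2) + 1) := by
  induction k generalizing l with
  | zero => rw [pow_zero, mul_one]; exact Exec.mono .skip (by omega)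
  | succ k ih =>
    refine ((run_mulLevel u v l b e o).seq (ih (l * b))).of_eq (by congr 1; ring) ?_
    have h1 : l * b * b ^ k = l * b ^ (k + 1) := by ring
    have h2 : l * (7 * b + 3) ≤ l * b ^ (k + 1) * (7 * b + 3) :=
      Nat.mul_le_mul_right _ (Nat.le_mul_of_pos_right _ (Nat.pow_pos hb))
    rw [h1, Nat.succ_mul k]
    omega

/-- Write the tokens of a template, with `shift` ticks for `none`. The last token is written first,
as the top of the output stack is the first token of the output. -/
def emit : TokenTemplate → StackProgram (RegSymbol α)
  | [] => .skip
  | some t :: l => .seq (emit l) (.push .out t)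
  | none :: l => .seq (emit l) (.seq
      (.popLoop .shift fun _ => .seq (.push .copy ()) (.push .out .tick))
      (.popLoop .copy fun _ => .push .shift ()))

theorem run_emit (x : TokenTemplate) (u v : List α) (l a b e : ℕ) (o : List Token) :
    Run (emit x) ⟨u, v, l, a, b, e, 0, o⟩ ⟨u, v, l, a, b, e, 0, x.expand e ++ o⟩
      (x.length * (5 * e + 2) + 1) := by
  have h1 : ∀ n c o, Run (.popLoop .shift fun _ => .seq (.push .copy ()) (.push .out .tick))
      ⟨u, v, l, a, b, n, c, o⟩ ⟨u, v, l, a, b, 0, c + n, List.replicate n .tick ++ o⟩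
      (3 * n + 1) := by
    intro n
    induction n with
    | zero => exact fun c o => .loop_nil rfl
    | succ n ih =>
      intro c o
      refine (Run.loop_shift rfl (.seq .push_copy (.push_out .tick))
        (ih (c + 1) (.tick :: o))).of_eq ?_ (by omega)
      congr 1
      · omega
      · rw [List.replicate_succ', List.append_assoc]; rfl
  have h2 : ∀ n e o, Run (.popLoop .copy fun _ => .push .shift ())
      ⟨u, v, l, a, b, e, n, o⟩ ⟨u, v, l, a, b, e + n, 0, o⟩ (2 * n + 1) := by
    intro n
    induction n with
    | zero => exact fun e o => .loop_nil rfl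
    | succ n ih =>
      intro e o
      exact (Run.loop_copy rfl .push_shift (ih (e + 1) o)).of_eq (by congr 1; omega) (by omega)
  induction x with
  | nil => exact Exec.mono .skip (by omega)
  | cons t x ih =>
    cases t with
    | some t =>
      refine (ih.seq (.push_out t)).of_eq rfl ?_
      rw [List.length_cons, Nat.succ_mul x.length]
      omega
    | none =>
      refine (ih.seq ((h1 e 0 _).seq (h2 _ 0 _))).of_eq ?_ ?_
      · simp [TokenTemplate.expand]
      · rw [List.length_cons, Nat.succ_mul x.length]
        omega

/-- Read a letter of the input, if there is one left, and write the template that depends on it. -/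
def emitNext (g : Option α → TokenTemplate) : StackProgram (RegSymbol α) :=
  .popCase .inp (emit (g none)) fun a => emit (g (some a))

theorem run_emitNext {g : Option α → TokenTemplate} {L : ℕ} (hg : ∀ x, (g x).length ≤ L)
    (u v : List α) (l a b e : ℕ) (o : List Token) :
    Run (emitNext g) ⟨u, v, l, a, b, e, 0, o⟩
      ⟨u.tail, v, l, a, b, e, 0, (g u.head?).expand e ++ o⟩ (L * (5 * e + 2) + 2) := by
  have ht : ∀ x, (g x).length * (5 * e + 2) + 1 ≤ L * (5 * e + 2) + 1 := fun x =>
    Nat.succ_le_succ (Nat.mul_le_mul_right _ (hg x))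
  cases u with
  | nil => exact Exec.popCaseNone rfl (Exec.mono (run_emit _ [] v l a b e o) (ht _))
  | cons x u =>
    refine Exec.popCaseSome (a := x) (r := u) rfl ?_
    rw [Regs.update_inp]
    exact Exec.mono (run_emit _ u v l a b e o) (ht _)

end StackProgram

namespace TapeMachine

open StackProgram

variable {α : Type} (M : TapeMachine α)

/-- The tokens of the transitions on one level. -/
noncomputable def levelTokens (x : Option α) : TokenTemplate :=
  (M.levelTemplates x).flatMap TransitionTemplate.tokens

/-- The tokens of the transitions on level `0`. -/
noncomputable def baseTokens (x : Option α) : TokenTemplate :=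
  (M.baseTemplates x).flatMap TransitionTemplate.tokens

/-- The rules of the query, as they are written down. -/
noncomputable def ruleTokens (w : List α) (s : ℕ) : List Token :=
  (M.transitions w s).flatMap fun t => t.rule.encode

theorem ruleTokens_zero (w : List α) :
    M.ruleTokens w 0 = (M.baseTokens w.head?).expand 0 := by
  have h := expand_flatMap_tokens (M.baseTemplates w[0]?) 0
  rw [Nat.mul_zero] at h
  rw [ruleTokens, transitions, baseTokens, List.head?_eq_getElem?, h]

theorem ruleTokens_succ (w : List α) (e : ℕ) :
    M.ruleTokens w (e + 1) =
      (M.levelTokens (w.drop (e + 1)).head?).expand (M.walkerCard * e) ++ M.ruleTokens w e := by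
  rw [ruleTokens, transitions, levelTokens, expand_flatMap_tokens, List.flatMap_append,
    List.head?_drop, ruleTokens]

/-- Write the rules of the levels from `1` to the value of `lvl`, in this order: `transitions` lists
the highest level first, and the output is written from its end. -/
noncomputable def emitLevels : StackProgram (RegSymbol α) :=
  .popLoop .lvl fun _ => .seq (emitNext M.levelTokens) (times (.push .shift ()) M.walkerCard)

variable {M}

theorem run_emitLevels {L : ℕ} (hL : ∀ x, (M.levelTokens x).length ≤ L) (w : List α) (s b : ℕ)
    (m : ℕ) : ∀ j, j + m = s →
      Run M.emitLevels ⟨w.drop (j + 1), [], m, 0, b, M.walkerCard * j, 0, M.ruleTokens w j⟩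
        ⟨w.drop (s + 1), [], 0, 0, b, M.walkerCard * s, 0, M.ruleTokens w s⟩
        (m * (L * (5 * (M.walkerCard * s) + 2) + M.walkerCard + 4) + 1) := by
  induction m with
  | zero =>
    rintro j rfl
    simp only [Nat.zero_mul, Nat.zero_add, Nat.add_zero]
    exact .loop_nil rfl
  | succ m ih =>
    intro j hj
    have h := (run_emitNext hL (w.drop (j + 1)) [] m 0 b (M.walkerCard * j)
      (M.ruleTokens w j)).seq (run_times_push_shift M.walkerCard _ _ _ _ _ _ _ _)
    rw [← M.ruleTokens_succ, List.tail_drop, ← Nat.mul_succ] at h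
    have hjs : L * (5 * (M.walkerCard * j) + 2) ≤ L * (5 * (M.walkerCard * s) + 2) := by
      gcongr; omega
    refine (Run.loop_lvl rfl h (ih (j + 1) (by omega))).of_eq rfl ?_
    rw [Nat.succ_mul m]
    omega

variable (M)

/-- The program that computes the query for space `(n + c) ^ k` on inputs of length `n`. The last
three loops clear the stacks that are not for the output. -/
noncomputable def queryProgram (c k : ℕ) : StackProgram (RegSymbol α) :=
  .seq readLength <| .seq (times (.push .base ()) c) <| .seq (.push .lvl ()) <|
  .seq (times mulLevel k) <| .seq (emitNext M.baseTokens) <| .seq M.emitLevels <|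
  .seq (emit ((encodeName (M.stateName (.goal, 0))).map some)) <|
  .seq (.popLoop .inp fun _ => .skip) <| .seq (.popLoop .base fun _ => .skip) <|
  .popLoop .shift fun _ => .skip

/-- The program computes the query in polynomial time. -/
theorem exists_queryProgram_time (c k : ℕ) (hc : 1 ≤ c) [Finite α] : ∃ T : Polynomial ℕ,
    ∀ w : List α, Run (M.queryProgram c k) ⟨w, [], 0, 0, 0, 0, 0, []⟩
      ⟨[], [], 0, 0, 0, 0, 0, (M.errorQuery w ((w.length + c) ^ k)).encode⟩
      (T.eval w.length) := by
  obtain ⟨L, hL⟩ : ∃ L, ∀ x, (M.levelTokens x).length ≤ L := by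
    obtain ⟨L, hL⟩ := (Set.finite_range fun x => (M.levelTokens x).length).bddAbove
    exact ⟨L, fun x => hL ⟨x, rfl⟩⟩
  obtain ⟨L', hL'⟩ : ∃ L, ∀ x, (M.baseTokens x).length ≤ L := by
    obtain ⟨L, hL⟩ := (Set.finite_range fun x => (M.baseTokens x).length).bddAbove
    exact ⟨L, fun x => hL ⟨x, rfl⟩⟩
  have h1 : ∀ (u : List α) l a b e o, Run (.popLoop .inp fun _ => .skip)
      ⟨u, [], l, a, b, e, 0, o⟩ ⟨[], [], l, a, b, e, 0, o⟩ (2 * u.length + 1) := by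
    intro u l a b e o
    induction u with
    | nil => exact .loop_nil rfl
    | cons x u ih => exact (Run.loop_inp rfl .skip ih).of_eq rfl (by simp; omega)
  have h2 : ∀ b e o, Run (α := α) (.popLoop .base fun _ => .skip)
      ⟨[], [], 0, 0, b, e, 0, o⟩ ⟨[], [], 0, 0, 0, e, 0, o⟩ (2 * b + 1) := by
    intro b e o
    induction b with
    | zero => exact .loop_nil rfl
    | succ b ih => exact (Run.loop_base rfl .skip ih).of_eq rfl (by omega)
  have h3 : ∀ e o, Run (α := α) (.popLoop .shift fun _ => .skip)
      ⟨[], [], 0, 0, 0, e, 0, o⟩ ⟨[], [], 0, 0, 0, 0, 0, o⟩ (2 * e + 1) := by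
    intro e o
    induction e with
    | zero => exact .loop_nil rfl
    | succ e ih => exact (Run.loop_shift rfl .skip ih).of_eq rfl (by omega)
  -- The time as a function of the input length and of the number of levels.
  let N : Polynomial ℕ := .X + .C c
  let s : Polynomial ℕ := N ^ k
  let B : Polynomial ℕ := .C M.walkerCard
  refine ⟨(5 * .X + 2) + ((.C c + 1) + (1 + ((.C k * (s * (7 * N + 3) + 2) + 1) +
    (.C (L' * 2 + 2) + ((s * (.C L * (5 * (B * s) + 2) + B + 4) + 1) +
    ((.C (M.stateName (.goal, 0) + 1) * (5 * (B * s) + 2) + 1) +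
    ((2 * .X + 1) + ((2 * N + 1) + (2 * (B * s) + 1))))))))), fun w => ?_⟩
  have e4 := run_times_mulLevel k w [] 1 (0 + w.length + c) 0 [] (by omega)
  have e5 := run_emitNext hL' w [] (1 * (0 + w.length + c) ^ k) 0 (0 + w.length + c) 0 []
  rw [← M.ruleTokens_zero, List.append_nil, ← List.drop_one] at e5
  have e6 := run_emitLevels hL w ((w.length + c) ^ k) (w.length + c) ((w.length + c) ^ k) 0
    (by simp)
  have e7 := run_emit ((encodeName (M.stateName (.goal, 0))).map some)
    (w.drop ((w.length + c) ^ k + 1)) [] 0 0 (w.length + c)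
    (M.walkerCard * (w.length + c) ^ k) (M.ruleTokens w ((w.length + c) ^ k))
  rw [TokenTemplate.expand_map_some, ruleTokens, ← errorQuery_encode] at e7
  simp only [Nat.zero_add, one_mul, Nat.mul_zero] at e4 e5 e6
  have e := (run_readLength w 0 0 0 0 0 []).seq <|
    (run_times_push_base c w [] 0 0 (0 + w.length) 0 0 []).seq <| Run.push_lvl.seq <|
    Run.seq (by simpa only [Nat.zero_add] using e4) <| e5.seq <| e6.seq <| e7.seq <|
    (h1 _ _ _ _ _ _).seq <| (h2 _ _ _).seq (h3 _ _)
  refine e.of_eq rfl ?_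
  simp only [N, s, B, Polynomial.eval_add, Polynomial.eval_mul, Polynomial.eval_pow,
    Polynomial.eval_X, Polynomial.eval_C, Polynomial.eval_one, Polynomial.eval_ofNat,
    List.length_map, List.length_drop]
  have h5 : (encodeName (M.stateName (.goal, 0))).length = M.stateName (.goal, 0) + 1 := by
    simp [encodeName]
  rw [h5]
  have h6 : w.length - ((w.length + c) ^ k + 1) ≤ w.length := Nat.sub_le _ _
  omega

end TapeMachine

/-! ### The reduction -/

/-- A polynomial is bounded by a power of a shift of the variable. -/
theorem exists_eval_le_pow (p : Polynomial ℕ) : ∃ c k, 1 ≤ c ∧ ∀ n, p.eval n ≤ (n + c) ^ k := by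
  induction p using Polynomial.induction_on' with
  | add p q hp hq =>
    obtain ⟨c, k, hc, h⟩ := hp
    obtain ⟨c', k', hc', h'⟩ := hq
    refine ⟨c + c', k + k' + 1, by omega, fun n => ?_⟩
    rw [Polynomial.eval_add]
    have h1 : p.eval n ≤ (n + (c + c')) ^ (k + k') := (h n).trans <|
      (Nat.pow_le_pow_left (by omega) k).trans (Nat.pow_le_pow_right (by omega) (by omega))
    have h2 : q.eval n ≤ (n + (c + c')) ^ (k + k') := (h' n).trans <|
      (Nat.pow_le_pow_left (by omega) k').trans (Nat.pow_le_pow_right (by omega) (by omega))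
    calc _ ≤ (n + (c + c')) ^ (k + k') * 2 := by omega
      _ ≤ _ := by rw [pow_succ]; exact Nat.mul_le_mul_left _ (by omega)
  | monomial m a =>
    refine ⟨a + 1, m + 1, by omega, fun n => ?_⟩
    rw [Polynomial.eval_monomial, pow_succ, mul_comm]
    exact Nat.mul_le_mul (Nat.pow_le_pow_left (by omega) m) (by omega)

theorem mainTheorem5 : PSpaceHard CLMQuery.encode CLMQuery.Bounded := by
  rintro α _ L ⟨M, p, hL, hp⟩
  obtain ⟨c, k, hc, hck⟩ := exists_eval_le_pow p
  refine ⟨fun w => M.errorQuery w ((w.length + c) ^ k), ?_, fun w => ?_⟩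
  · obtain ⟨T, hT⟩ := M.exists_queryProgram_time c k hc
    refine StackProgram.nonempty_computable (M.queryProgram c k) Reg.inp Reg.out T fun w => ?_
    have h1 : (Function.update (fun _ => []) Reg.inp w : ∀ r, List (RegSymbol α r)) =
        Regs.stk ⟨w, [], 0, 0, 0, 0, 0, []⟩ := by
      funext r; cases r <;> rfl
    have h2 : ∀ o : List Token,
        (Function.update (fun _ => []) Reg.out o : ∀ r, List (RegSymbol α r)) =
          Regs.stk ⟨[], [], 0, 0, 0, 0, 0, o⟩ := by
      intro o; funext r; cases r <;> rfl
    exact h1 ▸ h2 _ ▸ hT w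
  · rw [(hL w).2, TapeMachine.errorQuery_bounded_iff fun n =>
      (hp w n).le.trans (hck w.length)]
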